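/- For a finite field $\mathbf{F}_q$ and $n\ge 1$ let $L_n^*(\mathbf{F}_q)$ be the poset of nonzero proper subspaces of $\mathbf{F}_q^n$. For a prime $p$ (with $\mathbf{Z}_p$ the $p$-adic integers) and $r\ge 1$, the $r$th $p$-primary equivariant reduced Euler characteristic is $$\widetilde\chi^p_r(n,q)=\frac{1}{|\mathrm{GL}_n(\mathbf{F}_q)|}\sum_{X\in\mathrm{Hom}(\mathbf{Z}\times\mathbf{Z}_p^{r-1},\,\mathrm{GL}_n(\mathbf{F}_q))}\widetilde\chi\big(\{U\in L_n^*(\mathbf{F}_q): U \text{ is } X\text{-invariant}\}\big),$$ where $\widetilde\chi$ is the reduced Euler characteristic of the order complex, with $\widetilde\chi(\emptyset)=-1$. The $r$th $p$-primary generating function at $q$ is $F^p_r(x)(q)=1+\sum_{n\ge 1}\widetilde\chi^p_r(n,q)x^n$. Call integers $a,b$ prime to $p$ $p$-equivalent if the subgroups $\langle a\rangle$ and $\langle b\rangle$ of $\mathbf{Z}_p^\times$ have the same closure. Every odd prime power is $2$-equivalent to $3^{2^e}$ or to $-3^{2^e}=-(3^{2^e})$ for some $e\ge 0$, and each of these integers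 is $2$-equivalent to some prime power. For odd prime powers $q$, $F^2_r(x)(q)$ depends only on $r$ and the $2$-equivalence class of $q$; for $a=\pm 3^{2^e}$ write $F^2_r(x)(a)$ for the common value of $F^2_r(x)(q)$ at all prime powers $q$ that are $2$-equivalent to $a$. The $2$-primary generating functions at $-3$ determine all the others (at odd prime powers): for all $r\ge 1$, \begin{align*} (1+x)^{2^{r-2}}F^2_r(x)(3)&=\big((1-x)F^2_r(x^2)(-3)\big)^{2^{r-2}},\\ F^2_r(x)(3^{2^e})&=F^2_r(x)(-3)^{2^{e(r-1)}} && (e>0),\\ (1+x)^{2^{r-2}}F^2_r(x)(-3^{2^e})&=\big((1-x)F^2_r(x^2)(-3)^{2^{e(r-1)}}\big)^{2^{r-2}} && (e>0). \end{align*} These are identities in $\mathbf{Q}[[x]]$. For $r=1$ the exponent $2^{r-2}$ is $\tfrac12$; rational powers of a power series $F$ with constant term $1$ are given by the binomial series $F^c=\sum_{k\ge 0}\binom{c}{k}(F-1)^k$. -/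

import Mathlib

open scoped PowerSeries MatrixGroups

universe u v

noncomputable section

/-- The reduced Euler characteristic of (the order complex of) a finite poset `P`: the sum of
`(-1) ^ dim s` over all chains `s` in `P`, where `dim s = #s - 1`. The empty chain is included and
contributes `-1`; in particular the empty poset has reduced Euler characteristic `-1`. -/
def reducedEulerChar (P : Type*) [PartialOrder P] : ℤ :=
  ∑ᶠ s : {s : Finset P // IsChain (· ≤ ·) (s : Set P)}, (-1) ^ (s.1.card + 1)

/-- The poset of nonzero proper subspaces of `K ^ n` that are invariant under the image of
the homomorphism `X : A → GL_n(K)`, ordered by inclusion. -/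
abbrev FixedProperSubspace {K : Type*} [Field K] {n : ℕ} {A : Type*} [Group A]
    (X : A →* GL (Fin n) K) : Type _ :=
  {U : Submodule K (Fin n → K) //
    (U ≠ ⊥ ∧ U ≠ ⊤) ∧ ∀ a : A, U.map (Matrix.toLin' (X a : Matrix (Fin n) (Fin n) K)) = U}

/-- The group `ℤ × ℤ_p ^ m`, written multiplicatively. -/
abbrev IntPadicGroup (p m : ℕ) [Fact p.Prime] : Type :=
  Multiplicative (ℤ × (Fin m → ℤ_[p]))

/-- There are only finitely many homomorphisms from `ℤ × ℤ_p ^ m` to a finite group, so that the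
sum in the next definition is a genuine finite sum. (All of these homomorphisms are continuous.) -/
instance finite_intPadicGroup_hom (p m : ℕ) [Fact p.Prime] (G : Type*) [Group G] [Finite G] :
    Finite (IntPadicGroup p m →* G) := by
  obtain ⟨k, u, hu, hN⟩ := Nat.exists_eq_pow_mul_and_not_dvd (n := Nat.card G)
    Nat.card_pos.ne' p (Fact.out : p.Prime).ne_one
  have key : ∀ a : ℤ_[p], ∃ b, a = (a.appr k : ℤ_[p]) + (Nat.card G : ℤ_[p]) * b := by
    intro a
    obtain ⟨c, hc⟩ := Ideal.mem_span_singleton.1 (PadicInt.appr_spec k a)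
    have hunit : IsUnit (u : ℤ_[p]) := by
      rw [PadicInt.isUnit_iff]
      by_contra h
      exact hu (PadicInt.norm_natCast_lt_one_iff.1 (lt_of_le_of_ne (PadicInt.norm_le_one _) h))
    obtain ⟨v, hv⟩ := hunit.exists_right_inv
    refine ⟨v * c, ?_⟩
    rw [hN]
    push_cast
    linear_combination hc - (p : ℤ_[p]) ^ k * c * hv
  have hp : ∀ a : ℤ_[p], a.appr k < p ^ k := fun a => PadicInt.appr_lt a k
  have hNpos : (0 : ℤ) < Nat.card G := by exact_mod_cast Nat.card_pos
  let ρ : (IntPadicGroup p m →* G) → (Fin (Nat.card G) × (Fin m → Fin (p ^ k)) → G) :=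
    fun φ s => φ (Multiplicative.ofAdd (((s.1 : ℕ) : ℤ), fun i => ((s.2 i : ℕ) : ℤ_[p])))
  refine Finite.of_injective ρ fun φ ψ h => ?_
  refine MonoidHom.ext fun x => ?_
  choose b hb using fun i => key (x.toAdd.2 i)
  have hx : x = Multiplicative.ofAdd
        (((x.toAdd.1 % Nat.card G : ℤ), fun i => ((x.toAdd.2 i).appr k : ℤ_[p])))
      * (Multiplicative.ofAdd ((x.toAdd.1 / Nat.card G : ℤ), b)) ^ Nat.card G := by
    rw [← ofAdd_nsmul, ← ofAdd_add]
    apply Multiplicative.toAdd.injective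
    rw [toAdd_ofAdd]
    refine Prod.ext ?_ (funext fun i => ?_)
    · simp [Int.emod_add_mul_ediv]
    · simpa using hb i
  have hm : ((x.toAdd.1 % Nat.card G).toNat : ℤ) = x.toAdd.1 % Nat.card G :=
    Int.toNat_of_nonneg (Int.emod_nonneg _ hNpos.ne')
  have hlt : (x.toAdd.1 % Nat.card G).toNat < Nat.card G := by
    have := Int.emod_lt_of_pos x.toAdd.1 hNpos
    omega
  have hs := congrFun h (⟨_, hlt⟩, fun i => ⟨_, hp (x.toAdd.2 i)⟩)
  simp only [ρ] at hs
  rw [hm] at hs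
  rw [hx, map_mul, map_mul, map_pow, map_pow, pow_card_eq_one', pow_card_eq_one', hs]

/-- The `r`th `p`-primary equivariant reduced Euler characteristic (for `r ≥ 1`) of the
`GL_n(K)`-poset of nonzero proper subspaces of `K ^ n`, for a finite field `K`:
`1 / |GL_n(K)|` times the sum, over all homomorphisms `X : ℤ × ℤ_p ^ (r - 1) → GL_n(K)`, of the
reduced Euler characteristic of the poset of `X`-invariant nonzero proper subspaces. -/
def primaryEulerChar (p : ℕ) [Fact p.Prime] (r n : ℕ) (K : Type*) [Field K] : ℚ :=
  (∑ᶠ X : IntPadicGroup p (r - 1) →* GL (Fin n) K,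
      (reducedEulerChar (FixedProperSubspace X) : ℚ)) / Nat.card (GL (Fin n) K)

/-- The `r`th `p`-primary generating function at `q = |K|`: the power series with constant term `1`
whose `n`th coefficient, `n ≥ 1`, is the `r`th `p`-primary equivariant reduced Euler
characteristic. It is viewed as a power series over `ℚ`. -/
def primaryGenFun (p : ℕ) [Fact p.Prime] (r : ℕ) (K : Type*) [Field K] : ℚ⟦X⟧ :=
  PowerSeries.mk fun n => if n = 0 then 1 else primaryEulerChar p r n K

/-- Two integers `a`, `b` prime to `p` are `p`-equivalent if the subgroups of `ℤ_pˣ` that they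
generate have the same closure. -/
def PEquivalent (p : ℕ) [Fact p.Prime] (a b : ℤ) : Prop :=
  ∃ u v : ℤ_[p]ˣ, (u : ℤ_[p]) = a ∧ (v : ℤ_[p]) = b ∧
    (Subgroup.zpowers u).topologicalClosure = (Subgroup.zpowers v).topologicalClosure

/-- The power `F ^ c` of a power series `F` with constant term `1` to a rational exponent `c`,
given by the binomial series `∑ k, (c choose k) (F - 1) ^ k`. -/
def seriesPow (F : ℚ⟦X⟧) (c : ℚ) : ℚ⟦X⟧ :=
  (PowerSeries.binomialSeries ℚ c).subst (F - 1)

theorem seriesPow_hasSubst {F : ℚ⟦X⟧} (hF : PowerSeries.constantCoeff F = 1) :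
    PowerSeries.HasSubst (F - 1) :=
  PowerSeries.HasSubst.of_constantCoeff_zero' (by simp [hF])

theorem seriesPow_add {F : ℚ⟦X⟧} (hF : PowerSeries.constantCoeff F = 1) (c d : ℚ) :
    seriesPow F (c + d) = seriesPow F c * seriesPow F d := by
  rw [seriesPow, PowerSeries.binomialSeries_add, PowerSeries.subst_mul (seriesPow_hasSubst hF)]
  rfl

theorem seriesPow_natCast {F : ℚ⟦X⟧} (hF : PowerSeries.constantCoeff F = 1) (k : ℕ) :
    seriesPow F k = F ^ k := by
  have h := seriesPow_hasSubst hF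
  rw [seriesPow, PowerSeries.binomialSeries_nat, PowerSeries.subst_pow h, PowerSeries.subst_add h,
    PowerSeries.subst_X h, ← PowerSeries.coe_substAlgHom h, map_one]
  simp

end

/-! ### Euler characteristics and Möbius numbers of finite posets. -/

section EulerChar

/-! Everything follows from one formula, `hasLogDeriv_primaryGenFun`: if `p` is invertible in `K`
and `q = |K|`, then `x F'/F = -∑ₙ ((q ^ n - 1)_p) ^ (r - 1) xⁿ` for the `r`th generating function
`F`, where `(·)_p` denotes the `p`-part.

To prove it, fix a large `N` and let `G = (ℤ/p ^ N) ^ (r - 1)`. A homomorphism from `ℤ × ℤ_p ^ (r -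
1)` to `GL_n(K)` is a representation of `G` together with an automorphism of it (`padicHom`), and
the fixed poset is the proper part of the lattice of invariant subrepresentations. By Maschke's
theorem `K[G]` is semisimple, so a finite module is given by its multiplicities `m`. Let `α(m)` be
the average over `Aut V` of the Möbius number of the invariant lattice. Counting pairs `(U, g)` with
`g U = U` and applying the recursion of the Möbius function gives `∑_{k ≤ m} α(k) = δ_{m,0}`. Hence
`α(m)` is a product of coefficients of `1 - x`, and the coefficients of `F` up to a given degree are
those of `∏ (1 - x ^ dᵢ)`, where `dᵢ` are the dimensions of the simple `K[G]`-modules. The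
logarithmic derivative involves `∑_{dᵢ ∣ n} dᵢ`, which counts the algebra homomorphisms from `K[G]`
to the field with `q ^ n` elements, that is, the homomorphisms from `G` to a cyclic group of order
`q ^ n - 1`.

A series with constant term `1` is determined by its logarithmic derivative, so for `p = 2` only the
valuations of `q ^ n - 1` matter. They are invariants of the `2`-equivalence class and are computed
by lifting the exponent. For `3 ^ 2 ^ e` with `e > 0` they exceed those for `-3` by the constant
`e`, which gives a power of `F(-3)`. For a representative congruent to `3` modulo `4` they equal `1`
at odd `n`, and at `n = 2m` they exceed those for `-3` at `m` by `1 + e`. This produces the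
substitution of `x ^ 2` and the factors `1 ± x`. The exponent `2 ^ (r - 2)` is handled by squaring
both sides. -/

theorem reducedEulerChar_congr {P Q : Type*} [PartialOrder P] [PartialOrder Q] (e : P ≃o Q) :
    reducedEulerChar P = reducedEulerChar Q := by
  unfold reducedEulerChar
  have key : ∀ s : Finset P, IsChain (· ≤ ·) (s : Set P) ↔
      IsChain (· ≤ ·) ((e.toEquiv.finsetCongr s : Finset Q) : Set Q) := by
    intro s
    simp only [Equiv.finsetCongr_apply, Finset.coe_map]
    constructor
    · rintro h _ ⟨a, ha, rfl⟩ _ ⟨b, hb, rfl⟩ hab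
      have := h ha hb (fun h => hab (by rw [h]))
      simpa using this
    · intro h a ha b hb hab
      have := h ⟨a, ha, rfl⟩ ⟨b, hb, rfl⟩ (fun h => hab (e.injective h))
      simpa using this
  refine finsum_eq_of_bijective (Equiv.subtypeEquiv e.toEquiv.finsetCongr key)
    (Equiv.bijective _) fun s => ?_
  simp

/-- Nonempty chains with greatest element `x` correspond to chains in `Set.Iio x`. -/
theorem reducedEulerChar_eq_neg_one_sub_sum (P : Type*) [PartialOrder P] [Fintype P] :
    reducedEulerChar P = -1 - ∑ x : P, reducedEulerChar (Set.Iio x) := by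
  classical
  unfold reducedEulerChar
  simp_rw [finsum_eq_sum_of_fintype]
  let C (Q : Type _) [PartialOrder Q] := {s : Finset Q // IsChain (· ≤ ·) (s : Set Q)}
  let F : Option (Σ x : P, C (Set.Iio x)) → C P := fun o => match o with
    | none => ⟨∅, by simp⟩
    | some ⟨x, s⟩ => ⟨insert x (s.1.map (Function.Embedding.subtype _)), by
        rw [Finset.coe_insert]
        refine IsChain.insert ?_ ?_
        · rw [Finset.coe_map]
          rintro _ ⟨a, ha, rfl⟩ _ ⟨b, hb, rfl⟩ hab
          exact s.2 ha hb (fun h => hab (by rw [h]))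
        · intro b hb _
          obtain ⟨a, -, rfl⟩ := Finset.mem_map.1 hb
          exact Or.inr (le_of_lt a.2)⟩
  have hnot : ∀ (x : P) (s : C (Set.Iio x)), x ∉ s.1.map (Function.Embedding.subtype _) := by
    intro x s hx
    simp at hx
  have hF : Function.Bijective F := by
    constructor
    · rintro (_ | ⟨x, s⟩) (_ | ⟨y, t⟩) h
      · rfl
      · exact absurd (congrArg Subtype.val h).symm (Finset.insert_ne_empty _ _)
      · exact absurd (congrArg Subtype.val h) (Finset.insert_ne_empty _ _)
      · have h' : insert x (s.1.map (Function.Embedding.subtype _)) =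
            insert y (t.1.map (Function.Embedding.subtype _)) := congrArg Subtype.val h
        have hle : ∀ (a b : P) (s : C (Set.Iio a)) (t : C (Set.Iio b)),
            insert a (s.1.map (Function.Embedding.subtype _)) =
            insert b (t.1.map (Function.Embedding.subtype _)) → a ≤ b := by
          intro a b s t hab
          have : a ∈ insert b (t.1.map (Function.Embedding.subtype _)) := by
            rw [← hab]; exact Finset.mem_insert_self _ _
          rcases Finset.mem_insert.1 this with h | h
          · exact h.le
          · obtain ⟨c, -, rfl⟩ := Finset.mem_map.1 h
            exact le_of_lt c.2
        obtain rfl : x = y := le_antisymm (hle _ _ _ _ h') (hle _ _ _ _ h'.symm)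
        have h2 := congrArg (fun u => Finset.erase u x) h'
        simp only [Finset.erase_insert (hnot x _)] at h2
        have := Subtype.ext (Finset.map_injective _ h2)
        rw [this]
    · rintro ⟨s, hs⟩
      rcases s.eq_empty_or_nonempty with rfl | hne
      · exact ⟨none, rfl⟩
      · obtain ⟨x, hx, hmax⟩ := s.exists_maximal hne
        have hlt : ∀ y ∈ s.erase x, y < x := by
          intro y hy
          obtain ⟨h1, h2⟩ := Finset.mem_erase.1 hy
          rcases hs h2 hx h1 with h | h
          · exact lt_of_le_of_ne h h1
          · exact lt_of_le_of_ne (hmax h2 h) h1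
        refine ⟨some ⟨x, ⟨(s.erase x).subtype (· ∈ Set.Iio x), ?_⟩⟩, ?_⟩
        · intro a ha b hb hab
          have ha' : (a : P) ∈ s := by
            have := (Finset.mem_subtype.1 (Finset.mem_coe.1 ha)); exact Finset.mem_of_mem_erase this
          have hb' : (b : P) ∈ s := by
            have := (Finset.mem_subtype.1 (Finset.mem_coe.1 hb)); exact Finset.mem_of_mem_erase this
          exact hs ha' hb' (fun h => hab (Subtype.ext h))
        · apply Subtype.ext
          change insert x (((s.erase x).subtype (· ∈ Set.Iio x)).map _) = s
          have h4 : ((s.erase x).subtype (· ∈ Set.Iio x)).map (Function.Embedding.subtype _) =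
              s.erase x := Finset.subtype_map_of_mem hlt
          rw [h4, Finset.insert_erase hx]
  rw [← hF.sum_comp, Fintype.sum_option, Fintype.sum_sigma]
  have h2 : ∀ (x : P) (s : C (Set.Iio x)), (F (some ⟨x, s⟩)).1.card = s.1.card + 1 := by
    intro x s
    change (insert x _ : Finset P).card = _
    rw [Finset.card_insert_of_notMem (hnot x s), Finset.card_map]
  have h3 : (F none).1.card = 0 := rfl
  rw [h3, sub_eq_add_neg, ← Finset.sum_neg_distrib]
  congr 1
  refine Finset.sum_congr rfl fun x _ => ?_
  rw [← Finset.sum_neg_distrib]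
  refine Finset.sum_congr rfl fun s _ => ?_
  rw [h2, pow_succ]
  ring

/-- The Möbius number `μ(⊥, ⊤)` of a finite bounded poset. -/
noncomputable def mobiusNumber (P : Type*) [PartialOrder P] [BoundedOrder P] : ℤ :=
  open Classical in
  if Subsingleton P then 1 else reducedEulerChar {x : P // x ≠ ⊥ ∧ x ≠ ⊤}

theorem mobiusNumber_congr {P Q : Type*} [PartialOrder P] [BoundedOrder P] [PartialOrder Q]
    [BoundedOrder Q] (e : P ≃o Q) : mobiusNumber P = mobiusNumber Q := by
  classical
  unfold mobiusNumber
  have h : Subsingleton P ↔ Subsingleton Q := e.toEquiv.subsingleton_congr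
  refine if_congr h rfl (reducedEulerChar_congr ?_)
  refine
    { toEquiv := Equiv.subtypeEquiv e.toEquiv fun x => ?_, map_rel_iff' := ?_ }
  · simp
  · rintro ⟨a, ha⟩ ⟨b, hb⟩
    simp [← Subtype.coe_le_coe]

/-- The recursion `∑ μ(⊥, x) = δ` that defines the Möbius function, here derived from the chain
description of `μ` by sorting chains by their greatest element. -/
theorem sum_mobiusNumber_Iic (P : Type*) [PartialOrder P] [BoundedOrder P] [Fintype P]
    [Decidable (Subsingleton P)] :
    ∑ x : P, mobiusNumber (Set.Iic x) = if Subsingleton P then 1 else 0 := by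
  classical
  have hbot : mobiusNumber (Set.Iic (⊥ : P)) = 1 := by
    unfold mobiusNumber
    rw [if_pos]
    exact ⟨fun a b => Subtype.ext ((le_bot_iff.1 a.2).trans (le_bot_iff.1 b.2).symm)⟩
  split_ifs with hP
  · rw [Fintype.sum_subsingleton _ (⊥ : P), hbot]
  · have hne : (⊤ : P) ≠ ⊥ := fun h => hP (subsingleton_of_bot_eq_top h.symm)
    have hns : ∀ x : P, x ≠ ⊥ → mobiusNumber (Set.Iic x) =
        reducedEulerChar {y : Set.Iic x // y ≠ ⊥ ∧ y ≠ ⊤} := by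
      intro x hx
      unfold mobiusNumber
      rw [if_neg]
      intro h
      exact hx (congrArg Subtype.val (Subsingleton.elim (⊤ : Set.Iic x) ⊥))
    -- The term at `⊥` is `1`, the term at `⊤` is the Euler characteristic of the proper part, and
    -- the remaining terms are those of `reducedEulerChar_eq_neg_one_sub_sum`, so everything
    -- cancels.
    rw [← Finset.add_sum_erase _ _ (Finset.mem_univ (⊥ : P)), hbot,
      ← Finset.add_sum_erase _ _ (Finset.mem_erase.2 ⟨hne, Finset.mem_univ (⊤ : P)⟩),
      hns ⊤ hne]
    have htop : reducedEulerChar {y : Set.Iic (⊤ : P) // y ≠ ⊥ ∧ y ≠ ⊤} =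
        reducedEulerChar {y : P // y ≠ ⊥ ∧ y ≠ ⊤} := by
      refine reducedEulerChar_congr
        { toFun := fun y => ⟨y.1.1, fun h => y.2.1 (Subtype.ext h),
            fun h => y.2.2 (Subtype.ext h)⟩
          invFun := fun y => ⟨⟨y.1, le_top⟩, fun h => y.2.1 (congrArg Subtype.val h),
            fun h => y.2.2 (congrArg Subtype.val h)⟩
          left_inv := fun y => rfl
          right_inv := fun y => rfl
          map_rel_iff' := Iff.rfl }
    have hmid : ∀ x : {y : P // y ≠ ⊥ ∧ y ≠ ⊤}, mobiusNumber (Set.Iic x.1) =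
        reducedEulerChar (Set.Iio x) := by
      intro x
      rw [hns _ x.2.1]
      refine reducedEulerChar_congr
        { toFun := fun y => ⟨⟨y.1.1, fun h => y.2.1 (Subtype.ext h),
            ne_of_lt (lt_of_le_of_lt y.1.2 x.2.2.lt_top)⟩,
            lt_of_le_of_ne y.1.2 fun h => y.2.2 (Subtype.ext h)⟩
          invFun := fun y => ⟨⟨y.1.1, y.2.le⟩, fun h => y.1.2.1 (congrArg Subtype.val h),
            fun h => y.2.ne (congrArg (fun z : Set.Iic x.1 => z.1) h)⟩
          left_inv := fun y => rfl
          right_inv := fun y => rfl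
          map_rel_iff' := Iff.rfl }
    have hsum : ∑ x ∈ (Finset.univ.erase (⊥ : P)).erase ⊤, mobiusNumber (Set.Iic x) =
        ∑ x : {y : P // y ≠ ⊥ ∧ y ≠ ⊤}, reducedEulerChar (Set.Iio x) := by
      simp_rw [← hmid]
      refine Finset.sum_subtype (p := fun y : P => y ≠ ⊥ ∧ y ≠ ⊤) _ (fun x => ?_)
        (fun x => mobiusNumber (Set.Iic x))
      simp [and_comm]
    rw [htop, hsum, reducedEulerChar_eq_neg_one_sub_sum]
    ring

end EulerChar

/-! ### Invariant submodules and averages of Möbius numbers. -/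

section Modules

open scoped Pointwise

variable {R : Type*} [Ring R] {V : Type*} [AddCommGroup V] [Module R V]

/-- The submodules that are mapped onto themselves by an automorphism. -/
abbrev InvariantSubmodule (g : V ≃ₗ[R] V) : Type _ :=
  {U : Submodule R V // U.map (g : V →ₗ[R] V) = U}

instance (g : V ≃ₗ[R] V) : BoundedOrder (InvariantSubmodule g) where
  top := ⟨⊤, by simp⟩
  le_top U := le_top (a := U.1)
  bot := ⟨⊥, by simp⟩
  bot_le U := bot_le (a := U.1)

theorem InvariantSubmodule.subsingleton_iff (g : V ≃ₗ[R] V) :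
    Subsingleton (InvariantSubmodule g) ↔ Subsingleton V := by
  constructor
  · intro h
    rw [← Submodule.subsingleton_iff R]
    exact subsingleton_of_bot_eq_top
      (congrArg Subtype.val (Subsingleton.elim (⊥ : InvariantSubmodule g) ⊤))
  · intro h
    have := (Submodule.subsingleton_iff R).2 h
    infer_instance

/-- The restriction of an automorphism to an invariant submodule. -/
def restrictInvariant (g : V ≃ₗ[R] V) {U : Submodule R V} (hU : U.map (g : V →ₗ[R] V) = U) :
    U ≃ₗ[R] U :=
  g.ofSubmodules U U hU

theorem map_subtype_map_restrictInvariant (g : V ≃ₗ[R] V) {U : Submodule R V}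
    (hU : U.map (g : V →ₗ[R] V) = U) (W : Submodule R U) :
    (W.map (restrictInvariant g hU : U →ₗ[R] U)).map U.subtype =
      (W.map U.subtype).map (g : V →ₗ[R] V) := by
  rw [← Submodule.map_comp, ← Submodule.map_comp]
  rfl

/-- Invariant submodules below `U` are the invariant submodules of `U`. -/
def invariantSubmoduleIic (g : V ≃ₗ[R] V) (U : InvariantSubmodule g) :
    InvariantSubmodule (restrictInvariant g U.2) ≃o Set.Iic U where
  toFun W := ⟨⟨W.1.map U.1.subtype, by
    rw [← map_subtype_map_restrictInvariant g U.2, W.2]⟩, Submodule.map_subtype_le U.1 W.1⟩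
  invFun W := ⟨W.1.1.comap U.1.subtype, by
    apply Submodule.map_injective_of_injective U.1.injective_subtype
    have h : (W.1.1.comap U.1.subtype).map U.1.subtype = W.1.1 :=
      Submodule.map_comap_eq_self (by rw [Submodule.range_subtype]; exact W.2)
    rw [map_subtype_map_restrictInvariant g U.2, h, W.1.2]⟩
  left_inv W := Subtype.ext (Submodule.comap_map_eq_of_injective U.1.injective_subtype W.1)
  right_inv W := Subtype.ext (Subtype.ext (Submodule.map_comap_eq_self (by rw [Submodule.range_subtype]; exact W.2)))
  map_rel_iff' {W W'} := by
    change W.1.map U.1.subtype ≤ W'.1.map U.1.subtype ↔ W.1 ≤ W'.1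
    exact Submodule.map_le_map_iff_of_injective U.1.injective_subtype _ _

theorem sum_mobiusNumber_restrictInvariant [Finite V] (g : V ≃ₗ[R] V)
    [Fintype (InvariantSubmodule g)] [Decidable (Subsingleton V)] :
    ∑ U : InvariantSubmodule g, mobiusNumber (InvariantSubmodule (restrictInvariant g U.2)) =
      if Subsingleton V then 1 else 0 := by
  classical
  rw [← if_congr (InvariantSubmodule.subsingleton_iff g) rfl rfl,
    ← sum_mobiusNumber_Iic (InvariantSubmodule g)]
  exact Finset.sum_congr rfl fun U _ => mobiusNumber_congr (invariantSubmoduleIic g U)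

theorem mobiusNumber_invariantSubmodule_conj {W : Type*} [AddCommGroup W] [Module R W]
    (e : V ≃ₗ[R] W) (g : V ≃ₗ[R] V) (h : W ≃ₗ[R] W) (hgh : ∀ v, h (e v) = e (g v)) :
    mobiusNumber (InvariantSubmodule g) = mobiusNumber (InvariantSubmodule h) := by
  have key : ∀ U : Submodule R V, (U.map (e : V →ₗ[R] W)).map (h : W →ₗ[R] W) =
      (U.map (g : V →ₗ[R] V)).map (e : V →ₗ[R] W) := by
    intro U
    rw [← Submodule.map_comp, ← Submodule.map_comp]
    congr 1
    ext v
    exact hgh v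
  refine mobiusNumber_congr
    { toEquiv := Equiv.subtypeEquiv (Submodule.orderIsoMapComap e).toEquiv fun U => ?_
      map_rel_iff' := ?_ }
  · change _ ↔ (U.map (e : V →ₗ[R] W)).map (h : W →ₗ[R] W) = U.map (e : V →ₗ[R] W)
    rw [key]
    exact (Submodule.map_injective_of_injective e.injective).eq_iff.symm
  · intro a b
    exact (Submodule.orderIsoMapComap e).map_rel_iff'

instance [Finite V] : Finite (V ≃ₗ[R] V) := DFunLike.finite _

variable (R V) in
/-- The average over all automorphisms of the Möbius number of the lattice of invariant
submodules. -/
noncomputable def averageMobius : ℚ :=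
  (∑ᶠ g : V ≃ₗ[R] V, (mobiusNumber (InvariantSubmodule g) : ℚ)) / Nat.card (V ≃ₗ[R] V)

theorem averageMobius_congr {W : Type*} [AddCommGroup W] [Module R W] (e : V ≃ₗ[R] W) :
    averageMobius R V = averageMobius R W := by
  unfold averageMobius
  have E : (V ≃ₗ[R] V) ≃ (W ≃ₗ[R] W) :=
    { toFun := fun g => e.symm.trans (g.trans e)
      invFun := fun h => e.trans (h.trans e.symm)
      left_inv := fun g => by ext; simp
      right_inv := fun g => by ext; simp }
  rw [Nat.card_congr E]
  congr 1
  refine finsum_eq_of_bijective (fun g => e.symm.trans (g.trans e)) ?_ fun g => ?_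
  · exact ⟨fun g g' h => by
      ext v
      have := LinearEquiv.congr_fun h (e v)
      simpa using this, fun h => ⟨e.trans (h.trans e.symm), by ext; simp⟩⟩
  · exact congrArg _ (mobiusNumber_invariantSubmodule_conj e g _ fun v => by simp)

/-- All fibres of a surjective homomorphism have the same size, so averages over `G` and over `H`
agree. -/
theorem sum_comp_of_surjective {G H : Type*} [Group G] [Group H] [Fintype G] [Fintype H]
    (φ : G →* H) (hφ : Function.Surjective φ) (f : H → ℚ) :
    ∑ g, f (φ g) = Nat.card G * ((∑ h, f h) / Nat.card H) := by
  classical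
  have hc : ∀ h : H, (Finset.univ.filter fun g => φ g = h).card =
      (Finset.univ.filter fun g => φ g = 1).card := fun h =>
    MonoidHom.card_fiber_eq_of_mem_range φ (hφ h) (hφ 1)
  have h1 : ∀ f : H → ℚ, ∑ g, f (φ g) =
      (Finset.univ.filter fun g => φ g = 1).card * ∑ h, f h := by
    intro f
    rw [← Finset.sum_fiberwise_of_maps_to (s := Finset.univ) (t := Finset.univ) (g := φ)
      (fun _ _ => Finset.mem_univ _), Finset.mul_sum]
    refine Finset.sum_congr rfl fun h _ => ?_
    rw [← hc h, Finset.sum_congr rfl (g := fun _ => f h) (fun g hg => by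
      rw [(Finset.mem_filter.1 hg).2])]
    simp
  have h2 := h1 fun _ => 1
  simp only [Finset.sum_const, Finset.card_univ, nsmul_eq_mul, mul_one] at h2
  rw [Nat.card_eq_fintype_card, Nat.card_eq_fintype_card, h1, h2]
  have : (Fintype.card H : ℚ) ≠ 0 := by simp
  field_simp

theorem smul_submodule_eq_map (g : V ≃ₗ[R] V) (U : Submodule R V) :
    g • U = U.map (g : V →ₗ[R] V) := rfl

/-- The restriction of the stabilizer of `U` to `U`. -/
def stabilizerRestrict (U : Submodule R V) :
    MulAction.stabilizer (V ≃ₗ[R] V) U →* (U ≃ₗ[R] U) where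
  toFun g := restrictInvariant g.1 g.2
  map_one' := rfl
  map_mul' _ _ := rfl

/-- By semisimplicity `U` has a complement, and an automorphism of `U` extends by the identity on
it. -/
theorem stabilizerRestrict_surjective [IsSemisimpleModule R V] (U : Submodule R V) :
    Function.Surjective (stabilizerRestrict U) := by
  intro h
  obtain ⟨W, hW⟩ := exists_isCompl U
  let p := Submodule.prodEquivOfIsCompl U W hW
  let g : V ≃ₗ[R] V := p.symm.trans ((h.prodCongr (LinearEquiv.refl R W)).trans p)
  have hg : ∀ u : U, g u = h u := by
    intro u
    have : p.symm (u : V) = (u, 0) := by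
      rw [LinearEquiv.symm_apply_eq]
      simp [p]
    simp [g, this, p]
  have hs : g • U = U := by
    rw [smul_submodule_eq_map]
    ext v
    simp only [Submodule.mem_map]
    constructor
    · rintro ⟨u, hu, rfl⟩
      have := hg ⟨u, hu⟩
      change g u ∈ U
      rw [this]
      exact (h ⟨u, hu⟩).2
    · intro hv
      refine ⟨(h.symm ⟨v, hv⟩ : U), (h.symm ⟨v, hv⟩).2, ?_⟩
      exact (hg _).trans (by simp)
  refine ⟨⟨g, hs⟩, ?_⟩
  ext u
  exact hg u

/-- Double counting of the pairs `(U, g)` with `g U = U`, weighted by the Möbius number of `g` on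
`U`. For fixed `U`, the restrictions of the stabilizer are equidistributed in `Aut U`, which gives
the average; for fixed `g`, the Möbius recursion applies. -/
theorem sum_card_stabilizer_mul_averageMobius [Finite V] [IsSemisimpleModule R V]
    [Fintype (Submodule R V)] [Decidable (Subsingleton V)] :
    ∑ U : Submodule R V, Nat.card (MulAction.stabilizer (V ≃ₗ[R] V) U) * averageMobius R U =
      if Subsingleton V then (Nat.card (V ≃ₗ[R] V) : ℚ) else 0 := by
  classical
  have := Fintype.ofFinite (V ≃ₗ[R] V)
  have (U : Submodule R V) := Fintype.ofFinite (U ≃ₗ[R] U)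
  have h1 : ∀ U : Submodule R V,
      Nat.card (MulAction.stabilizer (V ≃ₗ[R] V) U) * averageMobius R U =
      ∑ g : MulAction.stabilizer (V ≃ₗ[R] V) U,
        (mobiusNumber (InvariantSubmodule (restrictInvariant g.1 g.2)) : ℚ) := by
    intro U
    rw [averageMobius, finsum_eq_sum_of_fintype,
      ← sum_comp_of_surjective (stabilizerRestrict U) (stabilizerRestrict_surjective U)
        (fun g => (mobiusNumber (InvariantSubmodule g) : ℚ))]
    rfl
  have h2 : ∀ g : V ≃ₗ[R] V, ∑ U : InvariantSubmodule g,
      (mobiusNumber (InvariantSubmodule (restrictInvariant g U.2)) : ℚ) =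
      if Subsingleton V then 1 else 0 := by
    intro g
    have := sum_mobiusNumber_restrictInvariant g
    exact_mod_cast this
  simp_rw [h1]
  let S : (Σ U : Submodule R V, MulAction.stabilizer (V ≃ₗ[R] V) U) ≃
      (Σ g : V ≃ₗ[R] V, InvariantSubmodule g) :=
    { toFun := fun x => ⟨x.2.1, x.1, x.2.2⟩
      invFun := fun x => ⟨x.2.1, x.1, x.2.2⟩
      left_inv := fun x => rfl
      right_inv := fun x => rfl }
  calc _ = ∑ x : (Σ U : Submodule R V, MulAction.stabilizer (V ≃ₗ[R] V) U),
        (mobiusNumber (InvariantSubmodule (restrictInvariant x.2.1 x.2.2)) : ℚ) :=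
      (Fintype.sum_sigma _).symm
    _ = ∑ x : (Σ g : V ≃ₗ[R] V, InvariantSubmodule g),
        (mobiusNumber (InvariantSubmodule (restrictInvariant x.1 x.2.2)) : ℚ) :=
      Fintype.sum_equiv S _ _ fun x => rfl
    _ = ∑ g : V ≃ₗ[R] V, if Subsingleton V then (1 : ℚ) else 0 :=
      (Fintype.sum_sigma _).trans (Finset.sum_congr rfl fun g _ => h2 g)
    _ = _ := by split_ifs <;> simp

end Modules

/-! ### Multiplicities of simple modules over a commutative semisimple ring. -/

section Classification

open scoped Pointwise

variable {R : Type*} [CommRing R]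

/-- The semisimple module in which the simple module `R ⧸ i` has multiplicity `m i`. -/
abbrev StdModule (m : MaximalSpectrum R → ℕ) : Type _ :=
  ∀ i : MaximalSpectrum R, Fin (m i) → R ⧸ i.asIdeal

/-- Multiplicities add up in direct sums. -/
noncomputable def stdModuleAdd (a b : MaximalSpectrum R → ℕ) :
    StdModule (a + b) ≃ₗ[R] StdModule a × StdModule b :=
  (LinearEquiv.piCongrRight fun i =>
    (LinearEquiv.funCongrLeft R (R ⧸ i.asIdeal) finSumFinEquiv).trans
      (LinearEquiv.sumArrowLequivProdArrow _ _ R (R ⧸ i.asIdeal))).trans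
  { toFun := fun f => (fun i => (f i).1, fun i => (f i).2)
    invFun := fun f i => (f.1 i, f.2 i)
    map_add' := fun _ _ => rfl
    map_smul' := fun _ _ => rfl
    left_inv := fun _ => rfl
    right_inv := fun _ => rfl }

theorem exists_linearEquiv_stdModule [IsSemisimpleRing R] (V : Type*) [AddCommGroup V] [Module R V]
    [Module.Finite R V] : ∃ m, Nonempty (V ≃ₗ[R] StdModule (R := R) m) := by
  classical
  obtain ⟨n, S, e, hS⟩ := IsSemisimpleModule.exists_linearEquiv_fin_dfinsupp R V
  have h1 : ∀ j, ∃ i : MaximalSpectrum R, Nonempty (S j ≃ₗ[R] R ⧸ i.asIdeal) := by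
    intro j
    obtain ⟨I, hI, he⟩ := isSimpleModule_iff_quot_maximal.1 (hS j)
    exact ⟨⟨I, hI⟩, he⟩
  choose c hc using h1
  let m : MaximalSpectrum R → ℕ := fun i => Fintype.card {j // c j = i}
  let σ : Fin n ≃ Σ i, Fin (m i) := (Equiv.sigmaFiberEquiv c).symm.trans
    (Equiv.sigmaCongrRight fun i => Fintype.equivFin _)
  have hσ : ∀ j, Nonempty (S j ≃ₗ[R] R ⧸ (σ j).1.asIdeal) := hc
  refine ⟨m, ⟨((e.trans (DFinsupp.linearEquivFunOnFintype (R := R))).trans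
    (LinearEquiv.piCongrRight fun j => (hσ j).some)).trans
    ((LinearEquiv.piCongrLeft R (fun x : Σ i, Fin (m i) => R ⧸ x.1.asIdeal) σ).trans
      (LinearEquiv.piCurry R (fun i (_ : Fin (m i)) => R ⧸ i.asIdeal)))⟩⟩

/-- The vectors of `StdModule m` killed by a maximal ideal. -/
noncomputable def stdModuleTorsion (m : MaximalSpectrum R → ℕ) (j : MaximalSpectrum R) :
    {v : StdModule m // ∀ r ∈ j.asIdeal, r • v = 0} ≃ (Fin (m j) → R ⧸ j.asIdeal) where
  toFun v := v.1 j
  invFun x := ⟨open Classical in Pi.single j x, fun r hr => by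
    classical
    rw [← Pi.single_smul]
    convert Pi.single_zero j using 2
    ext t
    obtain ⟨y, hy⟩ := Ideal.Quotient.mk_surjective (x t)
    rw [Pi.smul_apply, ← hy, Algebra.smul_def, Ideal.Quotient.algebraMap_eq, ← map_mul]
    exact Ideal.Quotient.eq_zero_iff_mem.2 (Ideal.mul_mem_right _ _ hr)⟩
  left_inv v := by
    classical
    apply Subtype.ext
    funext i
    by_cases hij : i = j
    · subst hij; simp
    · simp only [Pi.single_eq_of_ne hij]
      -- Distinct maximal ideals are incomparable, so some `r` in `j` acts invertibly on `R ⧸ i`; as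
      -- it kills `v`, the component of `v` at `i` vanishes.
      obtain ⟨r, hr, hri⟩ : ∃ r ∈ j.asIdeal, r ∉ i.asIdeal := by
        by_contra! h
        exact hij (MaximalSpectrum.ext (j.isMaximal.eq_of_le i.isMaximal.ne_top h).symm)
      funext t
      have h := congrFun (congrFun (v.2 r hr) i) t
      obtain ⟨y, hy⟩ := Ideal.Quotient.mk_surjective (v.1 i t)
      rw [Pi.smul_apply, Pi.smul_apply, ← hy, Algebra.smul_def, Ideal.Quotient.algebraMap_eq,
        ← map_mul] at h
      have h2 := (i.isMaximal.isPrime.mem_or_mem (Ideal.Quotient.eq_zero_iff_mem.1 h)).resolve_left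
        hri
      rw [← hy, Ideal.Quotient.eq_zero_iff_mem.2 h2]
      rfl
  right_inv x := by simp

instance finite_quotient_ideal [Finite R] (I : Ideal R) : Finite (R ⧸ I) :=
  Finite.of_surjective _ Ideal.Quotient.mk_surjective

instance finite_maximalSpectrum [Finite R] : Finite (MaximalSpectrum R) :=
  Finite.of_injective (fun i => i.asIdeal) fun _ _ => MaximalSpectrum.ext

/-- The multiplicity at `j` is recovered by counting: the vectors killed by `j` number `|R ⧸ j| ^ m
j`. -/
theorem stdModule_injective [Finite R] {m m' : MaximalSpectrum R → ℕ}
    (e : StdModule m ≃ₗ[R] StdModule m') : m = m' := by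
  funext j
  let E : {v : StdModule m // ∀ r ∈ j.asIdeal, r • v = 0} ≃
      {v : StdModule m' // ∀ r ∈ j.asIdeal, r • v = 0} :=
    Equiv.subtypeEquiv e.toEquiv fun v => by
      refine forall₂_congr fun r _ => ?_
      change _ ↔ r • e v = 0
      rw [← map_smul, map_eq_zero_iff _ e.injective]
  have h := Nat.card_congr (((stdModuleTorsion m j).symm.trans E).trans (stdModuleTorsion m' j))
  simp only [Nat.card_fun, Nat.card_eq_fintype_card, Fintype.card_fin] at h
  have : Nontrivial (R ⧸ j.asIdeal) := Ideal.Quotient.nontrivial_iff.2 j.isMaximal.ne_top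
  exact Nat.pow_right_injective Finite.one_lt_card h

variable [IsSemisimpleRing R] (V : Type*) [AddCommGroup V] [Module R V] [Module.Finite R V]

variable (R) in
/-- The multiplicities of the simple modules in a finite module. -/
noncomputable def multiplicities : MaximalSpectrum R → ℕ :=
  (exists_linearEquiv_stdModule (R := R) V).choose

variable (R) in
theorem nonempty_equiv_std : Nonempty (V ≃ₗ[R] StdModule (multiplicities R V)) :=
  (exists_linearEquiv_stdModule (R := R) V).choose_spec

variable {V}

theorem multiplicities_eq [Finite R] {m : MaximalSpectrum R → ℕ} (e : V ≃ₗ[R] StdModule m) :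
    multiplicities R V = m :=
  stdModule_injective ((nonempty_equiv_std R V).some.symm.trans e)

variable {W : Type*} [AddCommGroup W] [Module R W] [Module.Finite R W]

theorem multiplicities_congr [Finite R] (e : V ≃ₗ[R] W) :
    multiplicities R V = multiplicities R W :=
  multiplicities_eq (e.trans (nonempty_equiv_std R W).some)

theorem nonempty_equiv_of_multiplicities_eq (h : multiplicities R V = multiplicities R W) :
    Nonempty (V ≃ₗ[R] W) := by
  have e := (nonempty_equiv_std R V).some
  rw [h] at e
  exact ⟨e.trans (nonempty_equiv_std R W).some.symm⟩

theorem multiplicities_prod [Finite R] :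
    multiplicities R (V × W) = multiplicities R V + multiplicities R W :=
  multiplicities_eq (((nonempty_equiv_std R V).some.prodCongr (nonempty_equiv_std R W).some).trans
    (stdModuleAdd _ _).symm)

theorem multiplicities_add_of_isCompl [Finite R] {U U' : Submodule R V} (h : IsCompl U U') :
    multiplicities R U + multiplicities R U' = multiplicities R V :=
  multiplicities_prod.symm.trans (multiplicities_congr (Submodule.prodEquivOfIsCompl U U' h))

theorem multiplicities_submodule_le [Finite R] (U : Submodule R V) :
    multiplicities R U ≤ multiplicities R V := by
  obtain ⟨W, hW⟩ := exists_isCompl U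
  rw [← multiplicities_add_of_isCompl hW]
  exact le_self_add

theorem exists_submodule_multiplicities [Finite R] {k : MaximalSpectrum R → ℕ}
    (hk : k ≤ multiplicities R V) : ∃ U : Submodule R V, multiplicities R U = k := by
  obtain ⟨l, hl⟩ := exists_add_of_le hk
  have e := (nonempty_equiv_std R V).some
  rw [hl] at e
  let f : StdModule k →ₗ[R] V := (e.trans (stdModuleAdd k l)).symm.toLinearMap ∘ₗ
    LinearMap.inl R _ _
  have hf : Function.Injective f :=
    (e.trans (stdModuleAdd k l)).symm.injective.comp LinearMap.inl_injective
  exact ⟨LinearMap.range f, multiplicities_eq (LinearEquiv.ofInjective f hf).symm⟩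

/-- Multiplicities are additive and can be cancelled, so complements of `U` and `U'` are also
isomorphic; the two isomorphisms are glued. -/
theorem exists_smul_eq_of_multiplicities_eq [Finite R] {U U' : Submodule R V}
    (h : multiplicities R U = multiplicities R U') : ∃ g : V ≃ₗ[R] V, g • U = U' := by
  obtain ⟨W, hW⟩ := exists_isCompl U
  obtain ⟨W', hW'⟩ := exists_isCompl U'
  have h2 : multiplicities R W = multiplicities R W' := by
    have := (multiplicities_add_of_isCompl hW).trans (multiplicities_add_of_isCompl hW').symm
    rw [h] at this
    exact add_left_cancel this
  obtain ⟨a⟩ := nonempty_equiv_of_multiplicities_eq h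
  obtain ⟨b⟩ := nonempty_equiv_of_multiplicities_eq h2
  let g : V ≃ₗ[R] V := (Submodule.prodEquivOfIsCompl U W hW).symm.trans
    ((a.prodCongr b).trans (Submodule.prodEquivOfIsCompl U' W' hW'))
  have hg : ∀ u : U, g u = a u := by
    intro u
    have : (Submodule.prodEquivOfIsCompl U W hW).symm (u : V) = (u, 0) := by
      rw [LinearEquiv.symm_apply_eq]
      simp
    simp [g, this]
  refine ⟨g, ?_⟩
  rw [smul_submodule_eq_map]
  ext v
  simp only [Submodule.mem_map]
  constructor
  · rintro ⟨u, hu, rfl⟩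
    have := hg ⟨u, hu⟩
    change g u ∈ U'
    rw [this]
    exact (a ⟨u, hu⟩).2
  · intro hv
    exact ⟨(a.symm ⟨v, hv⟩ : U), (a.symm ⟨v, hv⟩).2, (hg _).trans (by simp)⟩

theorem exists_smul_eq_iff [Finite R] {U U' : Submodule R V} :
    (∃ g : V ≃ₗ[R] V, g • U = U') ↔ multiplicities R U = multiplicities R U' := by
  refine ⟨?_, exists_smul_eq_of_multiplicities_eq⟩
  rintro ⟨g, rfl⟩
  exact multiplicities_congr (g.submoduleMap U)

/-- The submodules of a given type form a single orbit of `Aut V`, so this is the orbit-stabilizer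
theorem. -/
theorem sum_card_stabilizer [Finite V] [Finite R] [Fintype (Submodule R V)]
    {k : MaximalSpectrum R → ℕ} (hk : k ≤ multiplicities R V) [DecidableEq (MaximalSpectrum R → ℕ)] :
    ∑ U ∈ Finset.univ.filter (fun U : Submodule R V => multiplicities R U = k),
      Nat.card (MulAction.stabilizer (V ≃ₗ[R] V) U) = Nat.card (V ≃ₗ[R] V) := by
  classical
  obtain ⟨U₀, rfl⟩ := exists_submodule_multiplicities hk
  have hst : ∀ U ∈ Finset.univ.filter (fun U : Submodule R V =>
      multiplicities R U = multiplicities R U₀),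
      Nat.card (MulAction.stabilizer (V ≃ₗ[R] V) U) =
      Nat.card (MulAction.stabilizer (V ≃ₗ[R] V) U₀) := by
    intro U hU
    obtain ⟨g, rfl⟩ := exists_smul_eq_of_multiplicities_eq (Finset.mem_filter.1 hU).2.symm
    exact Nat.card_congr (MulAction.stabilizerEquivStabilizer rfl).symm.toEquiv
  have horb : (Finset.univ.filter (fun U : Submodule R V =>
      multiplicities R U = multiplicities R U₀)).card =
      Nat.card (MulAction.orbit (V ≃ₗ[R] V) U₀) := by
    rw [← Nat.card_eq_finsetCard]
    refine Nat.card_congr (Equiv.subtypeEquivRight fun U => ?_)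
    rw [Finset.mem_filter, MulAction.mem_orbit_iff, exists_smul_eq_iff]
    simp [eq_comm]
  rw [Finset.sum_congr rfl hst, Finset.sum_const, horb, smul_eq_mul]
  have := Fintype.ofFinite (V ≃ₗ[R] V)
  have := Fintype.ofFinite (MulAction.orbit (V ≃ₗ[R] V) U₀)
  have := Fintype.ofFinite (MulAction.stabilizer (V ≃ₗ[R] V) U₀)
  simp only [Nat.card_eq_fintype_card]
  exact MulAction.card_orbit_mul_card_stabilizer_eq_card_group (V ≃ₗ[R] V) U₀

/-- In `sum_card_stabilizer_mul_averageMobius` the average depends only on the type of `U`, and the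
stabilizers of each type contribute exactly `|Aut V|`, which is then divided out. -/
theorem sum_averageMobius_stdModule [Finite R] [Fintype (MaximalSpectrum R)]
    [DecidableEq (MaximalSpectrum R)] (m : MaximalSpectrum R → ℕ) :
    ∑ k ∈ Fintype.piFinset fun i => Finset.range (m i + 1), averageMobius R (StdModule k) =
      if m = 0 then 1 else 0 := by
  classical
  have : Fintype (Submodule R (StdModule m)) := Fintype.ofFinite _
  have hm : multiplicities R (StdModule m) = m := multiplicities_eq (LinearEquiv.refl _ _)
  have h := sum_card_stabilizer_mul_averageMobius (R := R) (V := StdModule m)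
  have h1 : ∀ U : Submodule R (StdModule m),
      averageMobius R U = averageMobius R (StdModule (multiplicities R U)) :=
    fun U => averageMobius_congr (nonempty_equiv_std R U).some
  have hmem : ∀ k : MaximalSpectrum R → ℕ,
      k ∈ Fintype.piFinset (fun i => Finset.range (m i + 1)) ↔ k ≤ m := by
    intro k
    simp [Pi.le_def]
  rw [← Finset.sum_fiberwise_of_maps_to (s := Finset.univ)
    (t := Fintype.piFinset fun i => Finset.range (m i + 1))
    (g := fun U : Submodule R (StdModule m) => multiplicities R U) (fun U _ => by
      rw [hmem]
      exact (multiplicities_submodule_le U).trans hm.le)] at h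
  have h2 : ∀ k ∈ Fintype.piFinset fun i => Finset.range (m i + 1),
      ∑ U ∈ Finset.univ.filter (fun U : Submodule R (StdModule m) => multiplicities R U = k),
        Nat.card (MulAction.stabilizer (StdModule m ≃ₗ[R] StdModule m) U) * averageMobius R U =
      Nat.card (StdModule m ≃ₗ[R] StdModule m) * averageMobius R (StdModule k) := by
    intro k hk
    rw [hmem] at hk
    rw [← sum_card_stabilizer (hk.trans hm.ge), Nat.cast_sum, Finset.sum_mul]
    refine Finset.sum_congr rfl fun U hU => ?_
    rw [h1 U, (Finset.mem_filter.1 hU).2]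
  rw [Finset.sum_congr rfl h2, ← Finset.mul_sum] at h
  have hne : (Nat.card (StdModule m ≃ₗ[R] StdModule m) : ℚ) ≠ 0 := by
    exact_mod_cast Nat.card_pos.ne'
  have hsub : Subsingleton (StdModule m) ↔ m = 0 := by
    constructor
    · intro hs
      refine stdModule_injective (m := m) (m' := 0) ?_
      have : Subsingleton (StdModule (R := R) 0) :=
        ⟨fun a b => funext fun i => funext fun t => t.elim0⟩
      exact LinearEquiv.ofSubsingleton _ _
    · rintro rfl
      exact ⟨fun a b => funext fun i => funext fun t => t.elim0⟩
  rw [if_congr hsub rfl rfl] at h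
  split_ifs at h ⊢ with h0
  · exact mul_left_cancel₀ hne (h.trans (mul_one _).symm)
  · exact (mul_eq_zero.1 h).resolve_left hne

end Classification

/-! ### Möbius inversion over tuples of multiplicities. -/

section GeneratingFunction

/-- The inversion of the summatory function of a function of several natural numbers. -/
theorem eq_prod_coeff_of_sum_eq {ι : Type*} [Fintype ι] [DecidableEq ι] (α : (ι → ℕ) → ℚ)
    (h : ∀ m : ι → ℕ, ∑ k ∈ Fintype.piFinset fun i => Finset.range (m i + 1), α k =
      if m = 0 then 1 else 0) (m : ι → ℕ) :
    α m = ∏ i, PowerSeries.coeff (m i) (1 - PowerSeries.X : ℚ⟦X⟧) := by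
  have h1 : ∀ n : ℕ, ∑ j ∈ Finset.range (n + 1), PowerSeries.coeff j (1 - PowerSeries.X : ℚ⟦X⟧) =
      if n = 0 then 1 else 0 := by
    intro n
    induction n with
    | zero => simp
    | succ n ih =>
      rw [Finset.sum_range_succ, ih]
      rcases Nat.eq_zero_or_pos n with rfl | hn
      · simp [PowerSeries.coeff_one, PowerSeries.coeff_X]
      · simp [PowerSeries.coeff_one, PowerSeries.coeff_X, hn.ne']
  -- The partial sums of the coefficients of `1 - X` are `1, 0, 0, …`; the sum over a box of a
  -- product factors into these.
  have h2 : ∀ m : ι → ℕ, ∑ k ∈ Fintype.piFinset fun i => Finset.range (m i + 1),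
      ∏ i, PowerSeries.coeff (k i) (1 - PowerSeries.X : ℚ⟦X⟧) = if m = 0 then 1 else 0 := by
    intro m
    have h3 := Finset.prod_univ_sum (fun i => Finset.range (m i + 1))
      fun _ j => PowerSeries.coeff j (1 - PowerSeries.X : ℚ⟦X⟧)
    rw [← h3]
    simp_rw [h1]
    split_ifs with hm
    · simp [hm]
    · obtain ⟨i, hi⟩ := Function.ne_iff.1 hm
      exact Finset.prod_eq_zero (Finset.mem_univ i) (if_neg hi)
  -- Both functions solve the same triangular system, hence agree by induction on `∑ mᵢ`.
  have h3 : ∀ (n : ℕ) (m : ι → ℕ), ∑ i, m i = n →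
      α m = ∏ i, PowerSeries.coeff (m i) (1 - PowerSeries.X : ℚ⟦X⟧) := by
    intro n
    induction n using Nat.strong_induction_on with
    | _ n ih =>
      intro m hm
      have hmem : m ∈ Fintype.piFinset fun i => Finset.range (m i + 1) := by simp
      have h4 := (h m).trans (h2 m).symm
      rw [← Finset.add_sum_erase _ _ hmem, ← Finset.add_sum_erase _ _ hmem] at h4
      refine add_right_cancel (h4.trans (congrArg _ (Finset.sum_congr rfl fun k hk => ?_)))
      obtain ⟨hne, hk⟩ := Finset.mem_erase.1 hk
      have hle : k ≤ m := by
        intro i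
        have := Fintype.mem_piFinset.1 hk i
        simpa [Nat.lt_succ_iff] using this
      refine (ih _ ?_ k rfl).symm
      rw [← hm]
      obtain ⟨i, hi⟩ : ∃ i, k i < m i := by
        by_contra! hc
        exact hne (le_antisymm hle hc)
      exact Finset.sum_lt_sum (fun i _ => hle i) ⟨i, Finset.mem_univ _, hi⟩
  exact h3 _ m rfl

theorem coeff_prod_one_sub_X_pow {ι : Type*} [Fintype ι] [DecidableEq ι] (d : ι → ℕ) (n : ℕ) :
    PowerSeries.coeff n (∏ i, (1 - PowerSeries.X ^ d i) : ℚ⟦X⟧) =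
      ∑ m ∈ (Fintype.piFinset fun _ : ι => Finset.range (n + 2)) with ∑ i, m i * d i = n,
        ∏ i, PowerSeries.coeff (m i) (1 - PowerSeries.X : ℚ⟦X⟧) := by
  -- The bound `n + 2` guarantees that `0` and `1`, the only indices with a nonzero coefficient, lie
  -- in the range even for `n = 0`.
  have h1 : ∀ i, (1 - PowerSeries.X ^ d i : ℚ⟦X⟧) = ∑ j ∈ Finset.range (n + 2),
      PowerSeries.C (PowerSeries.coeff j (1 - PowerSeries.X : ℚ⟦X⟧)) *
        PowerSeries.X ^ (j * d i) := by
    intro i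
    rw [Finset.sum_range_succ', Finset.sum_range_succ', Finset.sum_eq_zero]
    · simp [PowerSeries.coeff_one, PowerSeries.coeff_X]
      ring
    · intro j _
      simp [PowerSeries.coeff_one, PowerSeries.coeff_X]
  simp_rw [h1]
  rw [Finset.prod_univ_sum, map_sum, Finset.sum_filter]
  refine Finset.sum_congr rfl fun m _ => ?_
  rw [Finset.prod_mul_distrib, ← map_prod, PowerSeries.coeff_C_mul, Finset.prod_pow_eq_pow_sum,
    PowerSeries.coeff_X_pow]
  simp [eq_comm]

end GeneratingFunction

/-! ### Representations of a finite abelian group over a finite field. -/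

section Representations

variable (K : Type*) [Field K] {R : Type*} [CommRing R] [Algebra K R] [Finite R]

theorem finrank_stdModule [Fintype (MaximalSpectrum R)] (m : MaximalSpectrum R → ℕ) :
    Module.finrank K (StdModule m) = ∑ i, m i * Module.finrank K (R ⧸ i.asIdeal) := by
  have : Module.Finite K R := Module.Finite.of_finite
  rw [Module.finrank_pi_fintype]
  refine Finset.sum_congr rfl fun i _ => ?_
  rw [Module.finrank_pi_fintype]
  simp

theorem coeff_prod_eq_sum_averageMobius [IsSemisimpleRing R] [Fintype (MaximalSpectrum R)]
    [DecidableEq (MaximalSpectrum R)] (n : ℕ) :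
    PowerSeries.coeff n (∏ i : MaximalSpectrum R,
      (1 - PowerSeries.X ^ Module.finrank K (R ⧸ i.asIdeal)) : ℚ⟦X⟧) =
      ∑ m ∈ (Fintype.piFinset fun _ : MaximalSpectrum R => Finset.range (n + 2)) with
        Module.finrank K (StdModule m) = n, averageMobius R (StdModule m) := by
  rw [coeff_prod_one_sub_X_pow]
  simp_rw [finrank_stdModule]
  refine Finset.sum_congr rfl fun m _ => ?_
  exact (eq_prod_coeff_of_sum_eq (fun m => averageMobius R (StdModule m))
    sum_averageMobius_stdModule m).symm

variable {K} [Finite K] {G : Type*} [CommGroup G] [Finite G]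

instance finite_monoidAlgebra : Finite (MonoidAlgebra K G) :=
  Module.finite_of_finite K

variable {V : Type*} [AddCommGroup V] [Module K V]

omit [Finite K] [Finite G] in
/-- Linear isomorphisms to a `MonoidAlgebra K G`-module that are compatible with a representation. -/
noncomputable def equivariantEquiv (ρ : Representation K G V) (M : Type*) [AddCommGroup M]
    [Module K M] [Module (MonoidAlgebra K G) M] [IsScalarTower K (MonoidAlgebra K G) M] :
    {ψ : V ≃ₗ[K] M // ∀ g v, ψ (ρ g v) = MonoidAlgebra.single g (1 : K) • ψ v} ≃
      (ρ.asModule ≃ₗ[MonoidAlgebra K G] M) where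
  toFun ψ := LinearEquiv.ofBijective
    (MonoidAlgebra.equivariantOfLinearOfComm (ρ.asModuleEquiv.trans ψ.1).toLinearMap
      (fun g v => by
        refine Eq.trans ?_ (ψ.2 g (ρ.asModuleEquiv v))
        simp
        rfl)) (ρ.asModuleEquiv.trans ψ.1).bijective
  invFun e := ⟨ρ.asModuleEquiv.symm.trans (e.restrictScalars K), fun g v => by
    have := e.map_smul (MonoidAlgebra.single g (1 : K)) (ρ.asModuleEquiv.symm v)
    refine Eq.trans ?_ this
    simp [Representation.asModuleEquiv_symm_map_rho]
    rfl⟩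
  left_inv ψ := by ext; rfl
  right_inv e := by ext; rfl

instance finite_asModule [Finite V] (ρ : Representation K G V) : Finite ρ.asModule :=
  inferInstanceAs (Finite V)

instance finite_representation [Finite V] : Finite (Representation K G V) := by
  have : Finite (V →ₗ[K] V) := DFunLike.finite _
  exact DFunLike.finite _

omit [Finite K] [Finite G] in
theorem existsUnique_representation {M : Type*} [AddCommGroup M]
    [Module K M] [Module (MonoidAlgebra K G) M] [IsScalarTower K (MonoidAlgebra K G) M]
    (ψ : V ≃ₗ[K] M) : ∃! ρ : Representation K G V,
      ∀ g v, ψ (ρ g v) = MonoidAlgebra.single g (1 : K) • ψ v := by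
  refine ⟨
    { toFun := fun g => ψ.symm.toLinearMap ∘ₗ
        (Algebra.lsmul K K M (MonoidAlgebra.single g (1 : K))) ∘ₗ ψ.toLinearMap
      map_one' := ?_
      map_mul' := ?_ }, ?_, ?_⟩
  · ext v
    simp [← MonoidAlgebra.one_def]
  · intro g h
    ext v
    simp [smul_smul, MonoidAlgebra.single_mul_single]
  · intro g v
    simp
  · intro ρ h
    ext g v
    simp [← h g v]

omit [Finite K] [Finite G] in
-- Transport of structure: each `K`-linear isomorphism from `V` to `M` is equivariant for exactly
-- one representation on `V`.
theorem sum_card_equiv [Finite V] [Fintype (Representation K G V)] (M : Type*) [AddCommGroup M]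
    [Module K M] [Module (MonoidAlgebra K G) M] [IsScalarTower K (MonoidAlgebra K G) M]
    [Finite M] : ∑ ρ : Representation K G V, Nat.card (ρ.asModule ≃ₗ[MonoidAlgebra K G] M) =
      Nat.card (V ≃ₗ[K] M) := by
  have : ∀ ρ : Representation K G V, Finite (ρ.asModule ≃ₗ[MonoidAlgebra K G] M) :=
    fun ρ => DFunLike.finite _
  have : Finite (V ≃ₗ[K] M) := DFunLike.finite _
  simp_rw [← Nat.card_congr (equivariantEquiv _ M)]
  rw [← Nat.card_sigma]
  refine Nat.card_congr (Equiv.ofBijective (fun x => x.2.1) ⟨?_, ?_⟩)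
  · rintro ⟨ρ, ψ, h⟩ ⟨ρ', ψ', h'⟩ (rfl : ψ = ψ')
    obtain rfl := (existsUnique_representation ψ).unique h h'
    rfl
  · intro ψ
    obtain ⟨ρ, h, -⟩ := existsUnique_representation (G := G) ψ
    exact ⟨⟨ρ, ψ, h⟩, rfl⟩

/-- The sum of Möbius numbers over all representations of `G` on `V` together with an
automorphism. -/
theorem sum_mobiusNumber_representation [NeZero (Nat.card G : K)] [Finite V]
    [Fintype (MaximalSpectrum (MonoidAlgebra K G))] [Fintype (Representation K G V)] :
    ∑ ρ : Representation K G V, ∑ᶠ g : ρ.asModule ≃ₗ[MonoidAlgebra K G] ρ.asModule,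
      (mobiusNumber (InvariantSubmodule g) : ℚ) = Nat.card (V ≃ₗ[K] V) *
      PowerSeries.coeff (Module.finrank K V) (∏ i : MaximalSpectrum (MonoidAlgebra K G),
        (1 - PowerSeries.X ^ Module.finrank K (MonoidAlgebra K G ⧸ i.asIdeal)) : ℚ⟦X⟧) := by
  classical
  have hfin : ∀ ρ : Representation K G V, Module.Finite (MonoidAlgebra K G) ρ.asModule :=
    fun ρ => Module.Finite.of_finite
  have : Module.Finite K V := Module.Finite.of_finite
  let μ (ρ : Representation K G V) := multiplicities (MonoidAlgebra K G) ρ.asModule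
  have h1 : ∀ ρ : Representation K G V,
      ∑ᶠ g : ρ.asModule ≃ₗ[MonoidAlgebra K G] ρ.asModule,
        (mobiusNumber (InvariantSubmodule g) : ℚ) =
      Nat.card (ρ.asModule ≃ₗ[MonoidAlgebra K G] ρ.asModule) *
        averageMobius (MonoidAlgebra K G) (StdModule (μ ρ)) := by
    intro ρ
    rw [← averageMobius_congr (nonempty_equiv_std (MonoidAlgebra K G) ρ.asModule).some,
      averageMobius, mul_div_cancel₀]
    exact_mod_cast Nat.card_pos.ne'
  have hdim : ∀ ρ : Representation K G V,
      Module.finrank K (StdModule (μ ρ)) = Module.finrank K V := fun ρ =>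
    (((nonempty_equiv_std (MonoidAlgebra K G) ρ.asModule).some.restrictScalars
      K).symm.trans ρ.asModuleEquiv).finrank_eq
  simp_rw [h1]
  rw [coeff_prod_eq_sum_averageMobius, ← Finset.sum_fiberwise_of_maps_to (s := Finset.univ)
    (t := (Fintype.piFinset fun _ : MaximalSpectrum (MonoidAlgebra K G) =>
      Finset.range (Module.finrank K V + 2)).filter
        fun m => Module.finrank K (StdModule m) = Module.finrank K V) (g := μ), Finset.mul_sum]
  · refine Finset.sum_congr rfl fun m hm => ?_
    obtain ⟨-, hm⟩ := Finset.mem_filter.1 hm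
    have e : Nonempty (V ≃ₗ[K] StdModule m) := FiniteDimensional.nonempty_linearEquiv_of_finrank_eq hm.symm
    have h2 : Nat.card (V ≃ₗ[K] V) = Nat.card (V ≃ₗ[K] StdModule m) :=
      Nat.card_congr
        { toFun := fun f => f.trans e.some
          invFun := fun f => f.trans e.some.symm
          left_inv := fun f => by ext; simp
          right_inv := fun f => by ext; simp }
    -- The isomorphisms from `ρ` to the standard module of type `m` are as many as the automorphisms
    -- of `ρ` if `ρ` has type `m`, and there are none otherwise.
    rw [h2, ← sum_card_equiv (G := G), Nat.cast_sum, Finset.sum_mul, Finset.sum_filter]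
    refine Finset.sum_congr rfl fun ρ _ => ?_
    split_ifs with h
    · obtain ⟨f⟩ := nonempty_equiv_std (MonoidAlgebra K G) ρ.asModule
      subst h
      congr 2
      exact Nat.card_congr
        { toFun := fun a => a.trans f
          invFun := fun a => a.trans f.symm
          left_inv := fun a => by ext; simp
          right_inv := fun a => by ext; simp }
    · have : IsEmpty (ρ.asModule ≃ₗ[MonoidAlgebra K G] StdModule m) :=
        ⟨fun f => h (multiplicities_eq f)⟩
      simp
  · intro ρ _
    -- Simple modules have positive dimension, so no multiplicity exceeds `dim V` and the finite
    -- index box misses no type.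
    refine Finset.mem_filter.2 ⟨Fintype.mem_piFinset.2 fun i => ?_, hdim ρ⟩
    have h3 := hdim ρ
    rw [finrank_stdModule] at h3
    have : Module.Finite K (MonoidAlgebra K G) := inferInstance
    have hpos : 0 < Module.finrank K (MonoidAlgebra K G ⧸ i.asIdeal) := by
      have : Nontrivial (MonoidAlgebra K G ⧸ i.asIdeal) :=
        Ideal.Quotient.nontrivial_iff.2 i.isMaximal.ne_top
      exact Module.finrank_pos
    have h4 := Finset.single_le_sum (f := fun i => μ ρ i *
      Module.finrank K (MonoidAlgebra K G ⧸ i.asIdeal)) (fun _ _ => Nat.zero_le _)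
      (Finset.mem_univ i)
    have h5 := Nat.le_mul_of_pos_right (μ ρ i) hpos
    rw [Finset.mem_range]
    omega

end Representations

/-! ### Dimensions of simple modules through embeddings into finite fields. -/

section CountAlgHom

variable {K R L : Type*} [Field K] [CommRing R] [Finite R] [Algebra K R] [Field L]
  [Algebra K L]

/-- An algebra homomorphism to a field is determined by its kernel and a map of fields. -/
theorem bijective_comp_quotient_mk : Function.Bijective
    (fun x : (Σ i : MaximalSpectrum R, (R ⧸ i.asIdeal) →ₐ[K] L) =>
      x.2.comp (Ideal.Quotient.mkₐ K x.1.asIdeal)) := by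
  constructor
  · rintro ⟨i, f⟩ ⟨j, g⟩ h
    have hker : ∀ (i : MaximalSpectrum R) (f : (R ⧸ i.asIdeal) →ₐ[K] L) (r : R),
        r ∈ i.asIdeal ↔ f.comp (Ideal.Quotient.mkₐ K i.asIdeal) r = 0 := by
      intro i f r
      constructor
      · intro hr
        simp [Ideal.Quotient.eq_zero_iff_mem.2 hr]
      · intro hr
        let := Ideal.Quotient.field i.asIdeal
        have hr' : f (Ideal.Quotient.mk i.asIdeal r) = 0 := hr
        rw [← Ideal.Quotient.eq_zero_iff_mem]
        exact (map_eq_zero_iff f f.toRingHom.injective).1 hr'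
    obtain rfl : i = j := by
      ext r
      rw [hker i f, hker j g]
      exact Eq.congr_left (DFunLike.congr_fun h r)
    congr 1
    ext x
    obtain ⟨r, rfl⟩ := Ideal.Quotient.mk_surjective x
    exact DFunLike.congr_fun h r
  · intro f
    have hprime : (RingHom.ker f).IsPrime := RingHom.ker_isPrime _
    exact ⟨⟨⟨RingHom.ker f, IsArtinianRing.isMaximal_of_isPrime _⟩, Ideal.kerLiftAlg f⟩, rfl⟩

/-- An extension of `K` of degree `d` has exactly `d` embeddings over `K` into `L` if `d` divides
the degree of `L`, and none otherwise. -/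
theorem sum_finrank_dvd_eq_card_algHom [Finite K] [Finite L] [Fintype (MaximalSpectrum R)] :
    (∑ i : MaximalSpectrum R,
      if Module.finrank K (R ⧸ i.asIdeal) ∣ Module.finrank K L then
        Module.finrank K (R ⧸ i.asIdeal) else 0) = Nat.card (R →ₐ[K] L) := by
  have hfin : ∀ i : MaximalSpectrum R, Finite ((R ⧸ i.asIdeal) →ₐ[K] L) :=
    fun i => DFunLike.finite _
  rw [← Nat.card_congr (Equiv.ofBijective _ (bijective_comp_quotient_mk (K := K) (R := R) (L := L))),
    Nat.card_sigma]
  refine Finset.sum_congr rfl fun i _ => ?_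
  let := Ideal.Quotient.field i.asIdeal
  split_ifs with h
  · exact (FiniteField.natCard_algHom_of_finrank_dvd h).symm
  · have : IsEmpty ((R ⧸ i.asIdeal) →ₐ[K] L) :=
      ⟨fun f => h (FiniteField.nonempty_algHom_iff_finrank_dvd.1 ⟨f⟩)⟩
    simp

/-- Homomorphisms from a cyclic group are determined by the image of a generator. -/
noncomputable def zmodHomEquiv (n : ℕ) (M : Type*) [CommGroup M] :
    (Multiplicative (ZMod n) →* M) ≃ (powMonoidHom n : M →* M).ker :=
  AddMonoidHom.toMultiplicativeLeft.symm.trans <| (ZMod.lift n).symm.trans <|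
    Equiv.subtypeEquiv ((zmultiplesHom (Additive M)).symm.trans Additive.toMul) fun f => by
      rw [MonoidHom.mem_ker]
      have : f (n : ℤ) = n • f 1 := by
        rw [← map_nsmul]; simp
      rw [this]
      exact Additive.toMul.apply_eq_iff_eq.symm

/-- Each coordinate is sent independently to an element killed by `n`, and a cyclic group `M` has
`gcd(|M|, n)` of these. -/
theorem card_zmod_pi_hom (m n : ℕ) (M : Type*) [CommGroup M] [Finite M] [IsCyclic M] :
    Nat.card ((Fin m → Multiplicative (ZMod n)) →* M) = (Nat.card M).gcd n ^ m := by
  rw [← Nat.card_congr (MonoidHom.noncommPiCoprodEquiv (ι := Fin m)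
      (N := fun _ => Multiplicative (ZMod n)) (M := M)),
    Nat.card_congr (Equiv.subtypeUnivEquiv (p := fun ϕ : ∀ _ : Fin m, Multiplicative (ZMod n) →* M =>
      Pairwise fun i j => ∀ (x y : Multiplicative (ZMod n)), Commute ((ϕ i) x) ((ϕ j) y))
      fun ϕ => fun i j _ x y => Commute.all _ _),
    Nat.card_pi]
  simp_rw [Nat.card_congr (zmodHomEquiv n M), IsCyclic.card_powMonoidHom_ker]
  simp

theorem card_algHom_monoidAlgebra (K L G : Type*) [Field K] [Field L] [Algebra K L] [CommGroup G] :
    Nat.card (MonoidAlgebra K G →ₐ[K] L) = Nat.card (G →* Lˣ) := by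
  rw [← Nat.card_congr (MonoidAlgebra.lift K L G)]
  exact Nat.card_congr
    { toFun := fun f => f.toHomUnits
      invFun := fun f => (Units.coeHom L).comp f
      left_inv := fun f => by ext; rfl
      right_inv := fun f => by ext; rfl }

/-- The degrees of the simple modules of `(ℤ/P)^m` over a finite field. -/
theorem sum_finrank_dvd_monoidAlgebra (K : Type*) [Field K] [Finite K] (m P n : ℕ) [NeZero P]
    [NeZero n] [Fintype (MaximalSpectrum (MonoidAlgebra K (Fin m → Multiplicative (ZMod P))))] :
    (∑ i : MaximalSpectrum (MonoidAlgebra K (Fin m → Multiplicative (ZMod P))),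
      if Module.finrank K (MonoidAlgebra K (Fin m → Multiplicative (ZMod P)) ⧸ i.asIdeal) ∣ n then
        Module.finrank K (MonoidAlgebra K (Fin m → Multiplicative (ZMod P)) ⧸ i.asIdeal) else 0) =
      (Nat.card K ^ n - 1).gcd P ^ m := by
  obtain ⟨p, hp⟩ := CharP.exists K
  have : Fact p.Prime := ⟨CharP.char_is_prime K p⟩
  let : Algebra (ZMod p) K := ZMod.algebra K p
  have h := sum_finrank_dvd_eq_card_algHom (K := K) (L := FiniteField.Extension K p n)
    (R := MonoidAlgebra K (Fin m → Multiplicative (ZMod P)))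
  rw [FiniteField.finrank_extension] at h
  rw [h, card_algHom_monoidAlgebra, card_zmod_pi_hom, Nat.card_units,
    FiniteField.natCard_extension]

end CountAlgHom

/-! ### Logarithmic derivatives of power series. -/

section LogDerivative

open PowerSeries

/-- The logarithmic derivative of `F`, multiplied by the variable, is `C`. -/
def HasLogDeriv (F C : ℚ⟦X⟧) : Prop :=
  X * derivative ℚ F = C * F

theorem HasLogDeriv.mul {F G C D : ℚ⟦X⟧} (hF : HasLogDeriv F C) (hG : HasLogDeriv G D) :
    HasLogDeriv (F * G) (C + D) := by
  unfold HasLogDeriv at *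
  rw [Derivation.leibniz, smul_eq_mul, smul_eq_mul]
  linear_combination F * hG + G * hF

theorem hasLogDeriv_one : HasLogDeriv 1 0 := by
  simp [HasLogDeriv]

theorem HasLogDeriv.pow {F C : ℚ⟦X⟧} (hF : HasLogDeriv F C) (n : ℕ) :
    HasLogDeriv (F ^ n) (n * C) := by
  induction n with
  | zero => simpa using hasLogDeriv_one
  | succ n ih =>
    rw [pow_succ]
    convert ih.mul hF using 1
    push_cast
    ring

theorem HasLogDeriv.prod {ι : Type*} (s : Finset ι) {F C : ι → ℚ⟦X⟧}
    (h : ∀ i ∈ s, HasLogDeriv (F i) (C i)) : HasLogDeriv (∏ i ∈ s, F i) (∑ i ∈ s, C i) := by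
  classical
  induction s using Finset.induction_on with
  | empty => simpa using hasLogDeriv_one
  | insert a s ha ih =>
    rw [Finset.prod_insert ha, Finset.sum_insert ha]
    exact (h a (Finset.mem_insert_self _ _)).mul
      (ih fun i hi => h i (Finset.mem_insert_of_mem hi))

theorem coeff_X_mul_derivative (F : ℚ⟦X⟧) (n : ℕ) :
    coeff n (X * derivative ℚ F) = n * coeff n F := by
  cases n with
  | zero => simp
  | succ n =>
    rw [coeff_succ_X_mul, coeff_derivative]
    push_cast
    ring

/-- Since `C` has no constant term, comparing coefficients expresses `n fₙ` through the `fₖ` with `k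
< n`. -/
theorem HasLogDeriv.eq {F G C : ℚ⟦X⟧} (hF : HasLogDeriv F C) (hG : HasLogDeriv G C)
    (hC : constantCoeff C = 0) (h0 : constantCoeff F = constantCoeff G) : F = G := by
  ext n
  induction n using Nat.strong_induction_on with
  | _ n ih =>
    rcases Nat.eq_zero_or_pos n with rfl | hn
    · simpa using h0
    · have h1 := congrArg (coeff n) hF
      have h2 := congrArg (coeff n) hG
      rw [coeff_X_mul_derivative, coeff_mul] at h1 h2
      have h3 : ∑ p ∈ Finset.HasAntidiagonal.antidiagonal n, coeff p.1 C * coeff p.2 F =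
          ∑ p ∈ Finset.HasAntidiagonal.antidiagonal n, coeff p.1 C * coeff p.2 G := by
        refine Finset.sum_congr rfl fun p hp => ?_
        rcases Nat.eq_zero_or_pos p.1 with h | h
        · rw [h, coeff_zero_eq_constantCoeff_apply, hC, zero_mul, zero_mul]
        · rw [ih p.2 (by have := Finset.HasAntidiagonal.mem_antidiagonal.1 hp; omega)]
      have hn' : (n : ℚ) ≠ 0 := by exact_mod_cast hn.ne'
      exact mul_left_cancel₀ hn' (h1.trans (h3.trans h2.symm))

theorem HasLogDeriv.expand_two {F C : ℚ⟦X⟧} (hF : HasLogDeriv F C) :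
    HasLogDeriv (expand 2 two_ne_zero F) (2 * expand 2 two_ne_zero C) := by
  have h := congrArg (expand 2 two_ne_zero) hF
  unfold HasLogDeriv
  rw [map_mul] at h
  ext n
  have h1 := congrArg (coeff n) h
  rw [← map_mul (expand 2 two_ne_zero), coeff_expand] at h1
  rw [coeff_X_mul_derivative, mul_assoc, ← map_ofNat (algebraMap ℚ ℚ⟦X⟧) 2, ← Algebra.smul_def,
    coeff_smul, ← map_mul (expand 2 two_ne_zero), ← h1, coeff_expand]
  split_ifs with hd
  · obtain ⟨k, rfl⟩ := hd
    rw [Nat.mul_div_cancel_left _ two_pos, coeff_X_mul_derivative]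
    push_cast
    simp
    ring
  · simp

/-- The geometric series of `-d X ^ d / (1 - X ^ d)`. -/
theorem hasLogDeriv_one_sub_X_pow {d : ℕ} (hd : d ≠ 0) :
    HasLogDeriv (1 - X ^ d) (-mk fun n => if n = 0 then 0 else if d ∣ n then (d : ℚ) else 0) := by
  unfold HasLogDeriv
  ext n
  rw [coeff_X_mul_derivative, mul_sub, mul_one, map_sub, map_sub, coeff_mul_X_pow']
  simp only [map_neg, coeff_mk, coeff_one, coeff_X_pow]
  rcases Nat.eq_zero_or_pos n with rfl | hn
  · simp [hd]
  · rcases lt_trichotomy n d with h | rfl | h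
    · have : ¬ d ∣ n := fun h' => absurd (Nat.le_of_dvd hn h') (by omega)
      simp [this, hn.ne', h.ne, not_le.2 h]
    · simp [hn.ne']
    · have h1 : n - d ≠ 0 := by omega
      have h2 : d ∣ n - d ↔ d ∣ n := by
        rw [Nat.dvd_sub_iff_left h.le dvd_rfl]
      simp [hn.ne', h.ne', h.le, h1, h2]

end LogDerivative

/-! ### Homomorphisms from `ℤ × ℤ_p ^ m` as representations with an automorphism. -/

section Bridge

open scoped Pointwise

variable (p m N : ℕ) [Fact p.Prime]

/-- Reduction of `p`-adic vectors modulo `p ^ N`. -/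
noncomputable def padicReduction :
    Multiplicative (Fin m → ℤ_[p]) →* (Fin m → Multiplicative (ZMod (p ^ N))) where
  toFun y i := Multiplicative.ofAdd (PadicInt.toZModPow N (y.toAdd i))
  map_one' := by ext; simp
  map_mul' x y := by ext; simp

theorem padicReduction_surjective : Function.Surjective (padicReduction p m N) := by
  intro b
  have h := fun i => ZMod.ringHom_surjective (PadicInt.toZModPow (p := p) N) (b i).toAdd
  choose y hy using h
  exact ⟨Multiplicative.ofAdd y, funext fun i => congrArg Multiplicative.ofAdd (hy i)⟩

variable {p m N}

/-- The order of `H` is a unit of `ℤ_p` times a power of `p` dividing `p ^ N`. So a vector divisible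
by `p ^ N` is divisible by `|H|`, and its image is a `|H|`th power. No continuity of `f` is needed.
-/
theorem map_eq_one_of_padicReduction_eq_one {H : Type*} [Group H] [Finite H]
    (hN : padicValNat p (Nat.card H) ≤ N) (f : Multiplicative (Fin m → ℤ_[p]) →* H)
    {y : Multiplicative (Fin m → ℤ_[p])} (hy : padicReduction p m N y = 1) : f y = 1 := by
  obtain ⟨k, u, hu, hk⟩ := Nat.exists_eq_pow_mul_and_not_dvd (n := Nat.card H)
    Nat.card_pos.ne' p (Fact.out : p.Prime).ne_one
  have hkN : k ≤ N := by
    refine le_trans ?_ hN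
    exact (padicValNat_dvd_iff_le Nat.card_pos.ne').1 (hk ▸ dvd_mul_right _ _)
  have hunit : IsUnit (u : ℤ_[p]) := by
    rw [PadicInt.isUnit_iff]
    by_contra h
    exact hu (PadicInt.norm_natCast_lt_one_iff.1 (lt_of_le_of_ne (PadicInt.norm_le_one _) h))
  obtain ⟨v, hv⟩ := hunit.exists_right_inv
  have key : ∀ i, ∃ b, y.toAdd i = (Nat.card H : ℤ_[p]) * b := by
    intro i
    have h1 : PadicInt.toZModPow N (y.toAdd i) = 0 := congrFun hy i
    rw [← RingHom.mem_ker, PadicInt.ker_toZModPow, Ideal.mem_span_singleton] at h1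
    obtain ⟨c, hc⟩ := h1
    obtain ⟨l, rfl⟩ := Nat.exists_eq_add_of_le hkN
    refine ⟨p ^ l * v * c, ?_⟩
    rw [hc, hk]
    push_cast
    rw [pow_add]
    linear_combination - (p : ℤ_[p]) ^ k * p ^ l * c * hv
  choose b hb using key
  have hy' : y = Multiplicative.ofAdd b ^ Nat.card H := by
    rw [← ofAdd_nsmul]
    apply Multiplicative.toAdd.injective
    funext i
    simpa using hb i
  rw [hy', map_pow, pow_card_eq_one']

variable {K : Type*} [Field K] {V : Type*} [AddCommGroup V] [Module K V] {G : Type*} [CommGroup G]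

/-- A representation as a homomorphism to the group of linear automorphisms. -/
noncomputable def Representation.toLinearEquivHom (ρ : Representation K G V) : G →* (V ≃ₗ[K] V) :=
  (LinearMap.GeneralLinearGroup.generalLinearEquiv K V).toMonoidHom.comp ρ.asGroupHom

/-- The `K`-linear automorphism underlying an automorphism of a representation. -/
noncomputable def Representation.underlyingEquiv (ρ : Representation K G V)
    (g : ρ.asModule ≃ₗ[MonoidAlgebra K G] ρ.asModule) : V ≃ₗ[K] V :=
  (ρ.asModuleEquiv.symm.trans (g.restrictScalars K)).trans ρ.asModuleEquiv

theorem Representation.underlyingEquiv_injective (ρ : Representation K G V) :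
    Function.Injective ρ.underlyingEquiv := by
  intro g h hgh
  ext v
  exact ρ.asModuleEquiv.injective (LinearEquiv.congr_fun hgh (ρ.asModuleEquiv v))

theorem Representation.underlyingEquiv_apply_rho (ρ : Representation K G V)
    (g : ρ.asModule ≃ₗ[MonoidAlgebra K G] ρ.asModule) (x : G) (v : V) :
    ρ.underlyingEquiv g (ρ x v) = ρ x (ρ.underlyingEquiv g v) := by
  have h1 := g.map_smul (MonoidAlgebra.single x (1 : K)) (ρ.asModuleEquiv.symm v)
  have h2 := congrArg ρ.asModuleEquiv h1
  simp only [Representation.asModuleEquiv_map_smul, Representation.asAlgebraHom_single_one] at h2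
  have h3 : MonoidAlgebra.single x (1 : K) • ρ.asModuleEquiv.symm v =
      ρ.asModuleEquiv.symm (ρ x v) :=
    (ρ.asModuleEquiv_symm_map_rho x v).symm
  rw [h3] at h2
  exact h2

theorem Representation.exists_underlyingEquiv_eq (ρ : Representation K G V) (h : V ≃ₗ[K] V)
    (hh : ∀ x v, h (ρ x v) = ρ x (h v)) : ∃ g, ρ.underlyingEquiv g = h := by
  refine ⟨equivariantEquiv ρ ρ.asModule ⟨h.trans ρ.asModuleEquiv.symm, fun x v => ?_⟩, by ext; rfl⟩
  change ρ.asModuleEquiv.symm (h (ρ x v)) = MonoidAlgebra.single x (1 : K) •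
    ρ.asModuleEquiv.symm (h v)
  rw [hh, Representation.asModuleEquiv_symm_map_rho]
  rfl

theorem Representation.commute_underlyingEquiv (ρ : Representation K G V)
    (g : ρ.asModule ≃ₗ[MonoidAlgebra K G] ρ.asModule) (x : G) :
    Commute (ρ.underlyingEquiv g) (ρ.toLinearEquivHom x) := by
  ext v
  exact ρ.underlyingEquiv_apply_rho g x v

/-- Submodules that are invariant under a representation and an automorphism of it. -/
noncomputable def invariantSubmoduleEquiv (ρ : Representation K G V)
    (g : ρ.asModule ≃ₗ[MonoidAlgebra K G] ρ.asModule) :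
    {U : Submodule K V // ρ.underlyingEquiv g • U = U ∧ ∀ x, ρ.toLinearEquivHom x • U = U} ≃o
      InvariantSubmodule g where
  toFun U := ⟨MonoidAlgebra.submoduleOfSMulMem (U.1.comap ρ.asModuleEquiv.toLinearMap)
    (fun x v hv => by
      have h := Submodule.smul_mem_pointwise_smul (ρ.asModuleEquiv v) (ρ.toLinearEquivHom x) U.1 hv
      rw [U.2.2 x] at h
      rw [Submodule.mem_comap]
      convert h using 1
      change ρ.asModuleEquiv (MonoidAlgebra.single x (1 : K) • v) = _
      rw [Representation.asModuleEquiv_map_smul, Representation.asAlgebraHom_single_one]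
      rfl), by
    have h := U.2.1
    apply SetLike.coe_injective
    exact congrArg (fun W : Submodule K V => (W : Set V)) h⟩
  invFun W := ⟨(W.1.restrictScalars K).comap ρ.asModuleEquiv.symm.toLinearMap, by
    constructor
    · apply SetLike.coe_injective
      exact congrArg (fun U : Submodule (MonoidAlgebra K G) ρ.asModule => (U : Set ρ.asModule)) W.2
    · have hle : ∀ x, ρ.toLinearEquivHom x •
          (W.1.restrictScalars K).comap ρ.asModuleEquiv.symm.toLinearMap ≤
          (W.1.restrictScalars K).comap ρ.asModuleEquiv.symm.toLinearMap := by
        rintro x _ ⟨v, hv, rfl⟩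
        have h := W.1.smul_mem (MonoidAlgebra.single x (1 : K)) hv
        refine Set.mem_of_eq_of_mem ?_ h
        exact ρ.asModuleEquiv_symm_map_rho x v
      intro x
      refine le_antisymm (hle x) ?_
      have h := Submodule.map_mono (f := (ρ.toLinearEquivHom x : V →ₗ[K] V)) (hle x⁻¹)
      rwa [← smul_submodule_eq_map, ← smul_submodule_eq_map, map_inv, smul_inv_smul] at h⟩
  left_inv U := rfl
  right_inv W := rfl
  map_rel_iff' := Iff.rfl

variable (p m N) in
/-- The homomorphism from `ℤ × ℤ_p ^ m` defined by a representation of `(ℤ/p ^ N) ^ m` and an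
automorphism of it. -/
noncomputable def padicHom
    (x : Σ ρ : Representation K (Fin m → Multiplicative (ZMod (p ^ N))) V,
      ρ.asModule ≃ₗ[MonoidAlgebra K (Fin m → Multiplicative (ZMod (p ^ N)))] ρ.asModule) :
    IntPadicGroup p m →* (V ≃ₗ[K] V) :=
  (MonoidHom.noncommCoprod (zpowersHom (V ≃ₗ[K] V) (x.1.underlyingEquiv x.2))
    (x.1.toLinearEquivHom.comp (padicReduction p m N)) fun z y => by
      rw [zpowersHom_apply]
      exact (x.1.commute_underlyingEquiv x.2 _).zpow_left _).comp
  (MulEquiv.prodMultiplicative ℤ (Fin m → ℤ_[p])).toMonoidHom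

theorem padicHom_apply
    (x : Σ ρ : Representation K (Fin m → Multiplicative (ZMod (p ^ N))) V,
      ρ.asModule ≃ₗ[MonoidAlgebra K (Fin m → Multiplicative (ZMod (p ^ N)))] ρ.asModule)
    (z : ℤ) (y : Fin m → ℤ_[p]) : padicHom p m N x (Multiplicative.ofAdd (z, y)) =
      x.1.underlyingEquiv x.2 ^ z *
        x.1.toLinearEquivHom (padicReduction p m N (Multiplicative.ofAdd y)) := rfl

theorem Representation.toLinearEquivHom_injective :
    Function.Injective (Representation.toLinearEquivHom (K := K) (V := V) (G := G)) := by
  intro ρ ρ' h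
  ext x v
  exact LinearEquiv.congr_fun (DFunLike.congr_fun h x) v

theorem padicHom_injective : Function.Injective (padicHom (K := K) (V := V) p m N) := by
  rintro ⟨ρ, g⟩ ⟨ρ', g'⟩ h
  have h1 : ρ.toLinearEquivHom = ρ'.toLinearEquivHom := by
    refine MonoidHom.ext fun b => ?_
    obtain ⟨y, rfl⟩ := padicReduction_surjective p m N b
    have := DFunLike.congr_fun h (Multiplicative.ofAdd (0, y.toAdd))
    simpa [padicHom_apply] using this
  obtain rfl := Representation.toLinearEquivHom_injective h1
  congr 1
  apply ρ.underlyingEquiv_injective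
  have := DFunLike.congr_fun h (Multiplicative.ofAdd (1, 0))
  simpa [padicHom_apply] using this

theorem padicHom_surjective [Finite V] (hN : padicValNat p (Nat.card (V ≃ₗ[K] V)) ≤ N) :
    Function.Surjective (padicHom (K := K) (V := V) p m N) := by
  intro X
  let f₀ : Multiplicative (Fin m → ℤ_[p]) →* (V ≃ₗ[K] V) :=
    (X.comp (MulEquiv.prodMultiplicative ℤ (Fin m → ℤ_[p])).symm.toMonoidHom).comp
      (MonoidHom.inr _ _)
  have hf₀ : ∀ y, f₀ (Multiplicative.ofAdd y) = X (Multiplicative.ofAdd (0, y)) := fun _ => rfl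
  have hker : (padicReduction p m N).ker ≤ f₀.ker := fun y hy =>
    map_eq_one_of_padicReduction_eq_one hN f₀ hy
  let f : (Fin m → Multiplicative (ZMod (p ^ N))) →* (V ≃ₗ[K] V) :=
    (padicReduction p m N).liftOfSurjective (padicReduction_surjective p m N) ⟨f₀, hker⟩
  have hf : ∀ y, f (padicReduction p m N y) = f₀ y := fun y =>
    MonoidHom.liftOfRightInverse_comp_apply _ _ _ ⟨f₀, hker⟩ y
  let ρ : Representation K (Fin m → Multiplicative (ZMod (p ^ N))) V :=
    { toFun := fun b => (f b : V →ₗ[K] V)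
      map_one' := by rw [map_one]; rfl
      map_mul' := fun a b => by rw [map_mul]; rfl }
  have hρ : ρ.toLinearEquivHom = f := by ext; rfl
  -- The image of the generator of `ℤ` commutes with the image of `ℤ_p ^ m`, so it is an
  -- automorphism of the representation.
  obtain ⟨g, hg⟩ := ρ.exists_underlyingEquiv_eq (X (Multiplicative.ofAdd (1, 0))) (by
    intro b v
    obtain ⟨y, rfl⟩ := padicReduction_surjective p m N b
    change X (Multiplicative.ofAdd (1, 0)) (f (padicReduction p m N y) v) =
      f (padicReduction p m N y) (X (Multiplicative.ofAdd (1, 0)) v)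
    have hcomm : X (Multiplicative.ofAdd (1, 0)) * X (Multiplicative.ofAdd (0, y.toAdd)) =
        X (Multiplicative.ofAdd (0, y.toAdd)) * X (Multiplicative.ofAdd (1, 0)) := by
      rw [← map_mul X, ← map_mul X, mul_comm]
    rw [hf y]
    exact LinearEquiv.congr_fun hcomm v)
  refine ⟨⟨ρ, g⟩, MonoidHom.ext fun a => ?_⟩
  obtain ⟨z, y⟩ := a
  change padicHom p m N ⟨ρ, g⟩ (Multiplicative.ofAdd (z, y)) = X (Multiplicative.ofAdd (z, y))
  rw [padicHom_apply]
  simp only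
  rw [hρ, hf, hf₀, hg, ← map_zpow, ← map_mul, ← ofAdd_zsmul, ← ofAdd_add]
  simp

variable (K) in
/-- Invertible matrices as linear automorphisms. -/
noncomputable def glEquiv (n : ℕ) : GL (Fin n) K ≃* ((Fin n → K) ≃ₗ[K] (Fin n → K)) :=
  Matrix.GeneralLinearGroup.toLin.trans
    (LinearMap.GeneralLinearGroup.generalLinearEquiv K (Fin n → K))

theorem coe_glEquiv {n : ℕ} (g : GL (Fin n) K) :
    (glEquiv K n g : (Fin n → K) →ₗ[K] (Fin n → K)) = Matrix.toLin' (g : Matrix _ _ K) := rfl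

theorem forall_padicHom_smul_eq_iff
    (x : Σ ρ : Representation K (Fin m → Multiplicative (ZMod (p ^ N))) V,
      ρ.asModule ≃ₗ[MonoidAlgebra K (Fin m → Multiplicative (ZMod (p ^ N)))] ρ.asModule)
    (U : Submodule K V) : (∀ a, padicHom p m N x a • U = U) ↔
      x.1.underlyingEquiv x.2 • U = U ∧ ∀ b, x.1.toLinearEquivHom b • U = U := by
  constructor
  · intro h
    constructor
    · have := h (Multiplicative.ofAdd (1, 0))
      simpa [padicHom_apply] using this
    · intro b
      obtain ⟨y, rfl⟩ := padicReduction_surjective p m N b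
      have := h (Multiplicative.ofAdd (0, y.toAdd))
      simpa [padicHom_apply] using this
  · rintro ⟨h1, h2⟩ ⟨z, y⟩
    change padicHom p m N x (Multiplicative.ofAdd (z, y)) ∈ MulAction.stabilizer (V ≃ₗ[K] V) U
    rw [padicHom_apply]
    exact mul_mem (zpow_mem (K := MulAction.stabilizer (V ≃ₗ[K] V) U) h1 z) (h2 _)

theorem reducedEulerChar_fixedProperSubspace {n : ℕ} (hn : n ≠ 0)
    (x : Σ ρ : Representation K (Fin m → Multiplicative (ZMod (p ^ N))) (Fin n → K),
      ρ.asModule ≃ₗ[MonoidAlgebra K (Fin m → Multiplicative (ZMod (p ^ N)))] ρ.asModule)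
    (X : IntPadicGroup p m →* GL (Fin n) K) (hX : ∀ a, glEquiv K n (X a) = padicHom p m N x a) :
    reducedEulerChar (FixedProperSubspace X) = mobiusNumber (InvariantSubmodule x.2) := by
  have hns : ¬ Subsingleton (InvariantSubmodule x.2) := by
    rw [InvariantSubmodule.subsingleton_iff]
    have : Nonempty (Fin n) := ⟨⟨0, Nat.pos_of_ne_zero hn⟩⟩
    exact not_subsingleton (Fin n → K)
  rw [mobiusNumber, if_neg hns]
  have hiff : ∀ U : Submodule K (Fin n → K),
      (∀ a, U.map (Matrix.toLin' (X a : Matrix (Fin n) (Fin n) K)) = U) ↔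
      x.1.underlyingEquiv x.2 • U = U ∧ ∀ b, x.1.toLinearEquivHom b • U = U := by
    intro U
    rw [← forall_padicHom_smul_eq_iff]
    refine forall_congr' fun a => ?_
    rw [← hX, smul_submodule_eq_map, coe_glEquiv]
  let e := invariantSubmoduleEquiv x.1 x.2
  have hbot : ∀ U, e U = ⊥ ↔ U.1 = ⊥ := by
    intro U
    rw [Subtype.ext_iff, SetLike.ext_iff, SetLike.ext_iff]
    exact forall_congr' fun v => Iff.rfl
  have htop : ∀ U, e U = ⊤ ↔ U.1 = ⊤ := by
    intro U
    rw [Subtype.ext_iff, SetLike.ext_iff, SetLike.ext_iff]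
    exact forall_congr' fun v => Iff.rfl
  refine reducedEulerChar_congr
    { toFun := fun U => ⟨e ⟨U.1, (hiff U.1).1 U.2.2⟩, fun h => U.2.1.1 ((hbot _).1 h),
        fun h => U.2.1.2 ((htop _).1 h)⟩
      invFun := fun W => ⟨(e.symm W.1).1,
        ⟨fun h => W.2.1 (by rw [← e.apply_symm_apply W.1]; exact (hbot _).2 h),
          fun h => W.2.2 (by rw [← e.apply_symm_apply W.1]; exact (htop _).2 h)⟩,
        (hiff _).2 (e.symm W.1).2⟩
      left_inv := fun U => rfl
      right_inv := fun W => rfl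
      map_rel_iff' := Iff.rfl }

end Bridge

/-! ### The logarithmic derivative of the generating function. -/

section GenFun

variable (p : ℕ) [Fact p.Prime] (K : Type*) [Field K] [Finite K]

theorem primaryEulerChar_eq_coeff (hp : (p : K) ≠ 0) (r N : ℕ) {n : ℕ} (hn : n ≠ 0)
    (hN : padicValNat p (Nat.card (GL (Fin n) K)) ≤ N)
    [Fintype (MaximalSpectrum (MonoidAlgebra K (Fin (r - 1) → Multiplicative (ZMod (p ^ N)))))] :
    primaryEulerChar p r n K = PowerSeries.coeff n
      (∏ i : MaximalSpectrum (MonoidAlgebra K (Fin (r - 1) → Multiplicative (ZMod (p ^ N)))),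
        (1 - PowerSeries.X ^ Module.finrank K
          (MonoidAlgebra K (Fin (r - 1) → Multiplicative (ZMod (p ^ N))) ⧸ i.asIdeal)) : ℚ⟦X⟧) := by
  classical
  have hp0 : NeZero p := ⟨(Fact.out : p.Prime).ne_zero⟩
  have hG : NeZero (Nat.card (Fin (r - 1) → Multiplicative (ZMod (p ^ N))) : K) := ⟨by
    rw [Nat.card_fun, Nat.card_congr Multiplicative.toAdd, Nat.card_zmod]
    push_cast
    exact pow_ne_zero _ (pow_ne_zero _ hp)⟩
  have hcard : Nat.card (GL (Fin n) K) = Nat.card ((Fin n → K) ≃ₗ[K] (Fin n → K)) :=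
    Nat.card_congr (glEquiv K n).toEquiv
  rw [hcard] at hN
  have := Fintype.ofFinite (Representation K (Fin (r - 1) → Multiplicative (ZMod (p ^ N)))
    (Fin n → K))
  have hsum := sum_mobiusNumber_representation (K := K) (V := Fin n → K)
    (G := Fin (r - 1) → Multiplicative (ZMod (p ^ N)))
  have hne : (Nat.card ((Fin n → K) ≃ₗ[K] (Fin n → K)) : ℚ) ≠ 0 := by
    have : Finite ((Fin n → K) ≃ₗ[K] (Fin n → K)) := DFunLike.finite _
    exact_mod_cast Nat.card_pos.ne'
  rw [Module.finrank_fin_fun] at hsum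
  rw [primaryEulerChar, hcard, div_eq_iff hne, mul_comm, ← hsum]
  let Ψ : (Σ ρ : Representation K (Fin (r - 1) → Multiplicative (ZMod (p ^ N))) (Fin n → K),
      ρ.asModule ≃ₗ[MonoidAlgebra K (Fin (r - 1) → Multiplicative (ZMod (p ^ N)))] ρ.asModule) →
      (IntPadicGroup p (r - 1) →* GL (Fin n) K) :=
    fun x => (glEquiv K n).symm.toMonoidHom.comp (padicHom p (r - 1) N x)
  have hΨ : ∀ x a, glEquiv K n (Ψ x a) = padicHom p (r - 1) N x a :=
    fun x a => (glEquiv K n).apply_symm_apply _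
  have hbij : Function.Bijective Ψ := by
    constructor
    · intro x y h
      apply padicHom_injective
      refine MonoidHom.ext fun a => ?_
      rw [← hΨ, ← hΨ, h]
    · intro X
      obtain ⟨x, hx⟩ := padicHom_surjective hN ((glEquiv K n).toMonoidHom.comp X)
      refine ⟨x, MonoidHom.ext fun a => (glEquiv K n).injective ?_⟩
      rw [hΨ, hx]
      rfl
  rw [← finsum_eq_of_bijective Ψ hbij (f := fun x =>
    (mobiusNumber (InvariantSubmodule x.2) : ℚ)) fun x => by
      rw [reducedEulerChar_fixedProperSubspace hn x (Ψ x) (hΨ x)]]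
  have (ρ : Representation K (Fin (r - 1) → Multiplicative (ZMod (p ^ N))) (Fin n → K)) :=
    Fintype.ofFinite (ρ.asModule ≃ₗ[MonoidAlgebra K
      (Fin (r - 1) → Multiplicative (ZMod (p ^ N)))] ρ.asModule)
  rw [finsum_eq_sum_of_fintype, Fintype.sum_sigma]
  exact Finset.sum_congr rfl fun ρ _ => (finsum_eq_sum_of_fintype _).symm

/-- The `p`-part of `q ^ n - 1`, raised to the power `r - 1`, with value `0` at `n = 0`. -/
noncomputable def pPartCoeff (p r q n : ℕ) : ℚ :=
  if n = 0 then 0 else ((p ^ padicValNat p (q ^ n - 1)) ^ (r - 1) : ℕ)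

theorem gcd_prime_pow {p M N : ℕ} [hp : Fact p.Prime] (hM : M ≠ 0) (hN : padicValNat p M ≤ N) :
    M.gcd (p ^ N) = p ^ padicValNat p M := by
  obtain ⟨k, -, hk⟩ := (Nat.dvd_prime_pow hp.out).1 (Nat.gcd_dvd_right M (p ^ N))
  rw [hk]
  congr 1
  apply le_antisymm
  · exact (padicValNat_dvd_iff_le hM).1 (hk ▸ Nat.gcd_dvd_left _ _)
  · rw [← Nat.pow_dvd_pow_iff_le_right hp.out.one_lt, ← hk]
    exact Nat.dvd_gcd pow_padicValNat_dvd (pow_dvd_pow p hN)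

theorem hasLogDeriv_primaryGenFun (hp : (p : K) ≠ 0) (r : ℕ) :
    HasLogDeriv (primaryGenFun p r K) (-PowerSeries.mk (pPartCoeff p r (Nat.card K))) := by
  classical
  have hq : 1 < Nat.card K := Finite.one_lt_card
  unfold HasLogDeriv
  ext n
  -- No single `N` serves all degrees, so the identity is checked one coefficient at a time. This
  -- `N` bounds all valuations that occur in degrees up to `n`, and both sides may then be compared
  -- with the finite product for `(ℤ/p ^ N) ^ (r - 1)`.
  let N := ∑ k ∈ Finset.range (n + 1),
    (padicValNat p (Nat.card (GL (Fin k) K)) + padicValNat p (Nat.card K ^ k - 1))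
  have hN : ∀ k ≤ n, padicValNat p (Nat.card (GL (Fin k) K)) +
      padicValNat p (Nat.card K ^ k - 1) ≤ N := fun k hk =>
    Finset.single_le_sum (f := fun k => padicValNat p (Nat.card (GL (Fin k) K)) +
      padicValNat p (Nat.card K ^ k - 1)) (fun _ _ => Nat.zero_le _)
      (Finset.mem_range.2 (Nat.lt_succ_of_le hk))
  have hp0 : NeZero p := ⟨(Fact.out : p.Prime).ne_zero⟩
  have := Fintype.ofFinite
    (MaximalSpectrum (MonoidAlgebra K (Fin (r - 1) → Multiplicative (ZMod (p ^ N)))))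
  let d (i : MaximalSpectrum (MonoidAlgebra K (Fin (r - 1) → Multiplicative (ZMod (p ^ N))))) : ℕ :=
    Module.finrank K
      (MonoidAlgebra K (Fin (r - 1) → Multiplicative (ZMod (p ^ N))) ⧸ i.asIdeal)
  have hd : ∀ i, d i ≠ 0 := by
    intro i
    have : Module.Finite K (MonoidAlgebra K (Fin (r - 1) → Multiplicative (ZMod (p ^ N)))) :=
      Module.Finite.of_finite
    have : Nontrivial (MonoidAlgebra K (Fin (r - 1) → Multiplicative (ZMod (p ^ N))) ⧸ i.asIdeal) :=
      Ideal.Quotient.nontrivial_iff.2 i.isMaximal.ne_top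
    exact Module.finrank_pos.ne'
  have hP := HasLogDeriv.prod Finset.univ fun i _ => hasLogDeriv_one_sub_X_pow (hd i)
  have hcoeff : ∀ k ≤ n, PowerSeries.coeff k (primaryGenFun p r K) =
      PowerSeries.coeff k (∏ i, (1 - PowerSeries.X ^ d i) : ℚ⟦X⟧) := by
    intro k hk
    rw [primaryGenFun, PowerSeries.coeff_mk]
    split_ifs with h0
    · subst h0
      simp [map_prod, hd]
    · exact primaryEulerChar_eq_coeff p K hp r N h0 (le_trans (Nat.le_add_right _ _) (hN k hk))
  have hC : ∀ k ≤ n, PowerSeries.coeff k (-PowerSeries.mk (pPartCoeff p r (Nat.card K))) =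
      PowerSeries.coeff k (∑ i, -PowerSeries.mk fun n =>
        if n = 0 then 0 else if d i ∣ n then (d i : ℚ) else 0) := by
    intro k hk
    simp only [map_sum, map_neg, PowerSeries.coeff_mk, Finset.sum_neg_distrib, pPartCoeff]
    split_ifs with h0
    · simp
    · congr 1
      have : NeZero k := ⟨h0⟩
      have h1 := sum_finrank_dvd_monoidAlgebra K (r - 1) (p ^ N) k
      have hM : Nat.card K ^ k - 1 ≠ 0 := by
        have := Nat.one_lt_pow h0 hq
        omega
      rw [gcd_prime_pow hM (le_trans (Nat.le_add_left _ _) (hN k hk))] at h1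
      rw [← h1]
      push_cast
      rfl
  have h1 := congrArg (PowerSeries.coeff n) hP
  rw [coeff_X_mul_derivative] at h1 ⊢
  rw [hcoeff n le_rfl, h1, PowerSeries.coeff_mul, PowerSeries.coeff_mul]
  refine Finset.sum_congr rfl fun x hx => ?_
  have hx := Finset.HasAntidiagonal.mem_antidiagonal.1 hx
  rw [hcoeff x.2 (by omega), hC x.1 (by omega)]

end GenFun

/-! ### `p`-equivalence and congruences modulo powers of `p`. -/

section PEquivalent

variable {p : ℕ} [Fact p.Prime]

theorem mem_topologicalClosure_zpowers_iff {u v : ℤ_[p]ˣ} :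
    v ∈ (Subgroup.zpowers u).topologicalClosure ↔
      ∀ k : ℕ, ∃ j : ℤ, (p : ℤ_[p]) ^ k ∣ (v : ℤ_[p]) - ((u ^ j : ℤ_[p]ˣ) : ℤ_[p]) := by
  rw [← SetLike.mem_coe, Subgroup.topologicalClosure_coe,
    Units.isOpenEmbedding_val.isInducing.closure_eq_preimage_closure_image, Set.mem_preimage,
    Metric.mem_closure_iff]
  have hp : 1 < (p : ℝ) := by exact_mod_cast (Fact.out : p.Prime).one_lt
  have hnorm : ∀ (x : ℤ_[p]) (k : ℕ), (p : ℤ_[p]) ^ k ∣ x ↔ ‖x‖ ≤ (p : ℝ) ^ (-(k : ℤ)) := by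
    intro x k
    rw [PadicInt.norm_le_pow_iff_mem_span_pow, Ideal.mem_span_singleton]
  constructor
  · intro h k
    obtain ⟨_, ⟨_, ⟨j, rfl⟩, rfl⟩, hj⟩ := h ((p : ℝ) ^ (-(k : ℤ))) (by positivity)
    exact ⟨j, (hnorm _ _).2 (by rw [dist_eq_norm] at hj; exact hj.le)⟩
  · intro h ε hε
    obtain ⟨k, hk⟩ := exists_pow_lt_of_lt_one hε (inv_lt_one_of_one_lt₀ hp)
    obtain ⟨j, hj⟩ := h k
    refine ⟨_, ⟨_, ⟨j, rfl⟩, rfl⟩, ?_⟩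
    rw [dist_eq_norm]
    refine lt_of_le_of_lt ((hnorm _ _).1 hj) ?_
    rwa [zpow_neg, zpow_natCast, ← inv_pow]

/-- Modulo `p ^ k` the element `v` is a power of `u`, so its order divides that of `u`. -/
theorem dvd_pow_sub_one_of_mem_topologicalClosure {u v : ℤ_[p]ˣ}
    (h : v ∈ (Subgroup.zpowers u).topologicalClosure) (k n : ℕ)
    (hu : (p : ℤ_[p]) ^ k ∣ (u : ℤ_[p]) ^ n - 1) : (p : ℤ_[p]) ^ k ∣ (v : ℤ_[p]) ^ n - 1 := by
  obtain ⟨j, hj⟩ := mem_topologicalClosure_zpowers_iff.1 h k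
  have hker : ∀ x : ℤ_[p], (p : ℤ_[p]) ^ k ∣ x ↔ PadicInt.toZModPow k x = 0 := by
    intro x
    rw [← RingHom.mem_ker, PadicInt.ker_toZModPow, Ideal.mem_span_singleton]
  let f : ℤ_[p]ˣ →* (ZMod (p ^ k))ˣ := Units.map (PadicInt.toZModPow (p := p) k).toMonoidHom
  have hiff : ∀ w : ℤ_[p]ˣ, (p : ℤ_[p]) ^ k ∣ (w : ℤ_[p]) ^ n - 1 ↔ f w ^ n = 1 := by
    intro w
    rw [hker, map_sub, map_one, map_pow, sub_eq_zero, Units.ext_iff]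
    rfl
  have hfv : f v = f u ^ j := by
    rw [← map_zpow]
    rw [hker, map_sub, sub_eq_zero] at hj
    exact Units.ext hj
  rw [hiff] at hu ⊢
  rw [hfv, ← zpow_natCast, ← zpow_mul, mul_comm, zpow_mul, zpow_natCast, hu, one_zpow]

theorem PEquivalent.padicValInt_pow_sub_one {a b : ℤ} (h : PEquivalent p a b) (n : ℕ) :
    padicValInt p (a ^ n - 1) = padicValInt p (b ^ n - 1) := by
  obtain ⟨u, v, hu, hv, huv⟩ := h
  have h1 : ∀ k, (p : ℤ) ^ k ∣ a ^ n - 1 ↔ (p : ℤ) ^ k ∣ b ^ n - 1 := by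
    intro k
    rw [← PadicInt.pow_p_dvd_int_iff, ← PadicInt.pow_p_dvd_int_iff]
    push_cast
    rw [← hu, ← hv]
    exact ⟨dvd_pow_sub_one_of_mem_topologicalClosure
        (huv ▸ Subgroup.le_topologicalClosure _ (Subgroup.mem_zpowers v)) k n,
      dvd_pow_sub_one_of_mem_topologicalClosure
        (huv ▸ Subgroup.le_topologicalClosure _ (Subgroup.mem_zpowers u)) k n⟩
  -- Zero is treated apart: it is divisible by every power of `p`, but `padicValInt` gives it the
  -- value `0`.
  have h0 : a ^ n - 1 = 0 ↔ b ^ n - 1 = 0 := by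
    have : ∀ x : ℤ, x = 0 ↔ ∀ k, (p : ℤ) ^ k ∣ x := by
      intro x
      refine ⟨fun h k => h ▸ dvd_zero _, fun h => ?_⟩
      by_contra hx
      have := ((padicValInt_dvd_iff _ _).1 (h (padicValInt p x + 1))).resolve_left hx
      omega
    rw [this, this]
    exact forall_congr' h1
  by_cases ha : a ^ n - 1 = 0
  · rw [ha, h0.1 ha]
  · have hb := fun hb => ha (h0.2 hb)
    apply le_antisymm
    · exact ((padicValInt_dvd_iff _ _).1 ((h1 _).1 (padicValInt_dvd _))).resolve_left hb
    · exact ((padicValInt_dvd_iff _ _).1 ((h1 _).2 (padicValInt_dvd _))).resolve_left ha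

theorem PEquivalent.symm {a b : ℤ} (h : PEquivalent p a b) : PEquivalent p b a := by
  obtain ⟨u, v, hu, hv, huv⟩ := h
  exact ⟨v, u, hv, hu, huv.symm⟩

theorem PEquivalent.not_dvd {a b : ℤ} (h : PEquivalent p a b) : ¬ (p : ℤ) ∣ a := by
  obtain ⟨u, v, hu, -, -⟩ := h
  rw [← PadicInt.norm_int_lt_one_iff_dvd, ← hu, PadicInt.norm_units]
  exact lt_irrefl _

theorem exists_padicInt_unit {a : ℤ} (ha : ¬ (p : ℤ) ∣ a) : ∃ u : ℤ_[p]ˣ, (u : ℤ_[p]) = a := by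
  have : IsUnit (a : ℤ_[p]) := by
    rw [PadicInt.isUnit_iff]
    by_contra h
    exact ha ((PadicInt.norm_int_lt_one_iff_dvd a).1 (lt_of_le_of_ne (PadicInt.norm_le_one _) h))
  exact this

theorem PEquivalent.refl {a : ℤ} (ha : ¬ (p : ℤ) ∣ a) : PEquivalent p a a := by
  obtain ⟨u, hu⟩ := exists_padicInt_unit ha
  exact ⟨u, u, hu, hu, rfl⟩

theorem pEquivalent_of_forall_dvd {a b : ℤ} (ha : ¬ (p : ℤ) ∣ a) (hb : ¬ (p : ℤ) ∣ b)
    (hab : ∀ k : ℕ, ∃ j : ℕ, (p : ℤ) ^ k ∣ b - a ^ j)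
    (hba : ∀ k : ℕ, ∃ j : ℕ, (p : ℤ) ^ k ∣ a - b ^ j) : PEquivalent p a b := by
  obtain ⟨u, hu⟩ := exists_padicInt_unit ha
  obtain ⟨v, hv⟩ := exists_padicInt_unit hb
  have key : ∀ (a b : ℤ) (u v : ℤ_[p]ˣ), (u : ℤ_[p]) = a → (v : ℤ_[p]) = b →
      (∀ k : ℕ, ∃ j : ℕ, (p : ℤ) ^ k ∣ b - a ^ j) →
      (Subgroup.zpowers v).topologicalClosure ≤ (Subgroup.zpowers u).topologicalClosure := by
    intro a b u v hu hv h
    refine Subgroup.topologicalClosure_minimal _ ?_ (Subgroup.isClosed_topologicalClosure _)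
    rw [Subgroup.zpowers_le, mem_topologicalClosure_zpowers_iff]
    intro k
    obtain ⟨j, hj⟩ := h k
    refine ⟨j, ?_⟩
    rw [← PadicInt.pow_p_dvd_int_iff] at hj
    push_cast at hj
    rw [zpow_natCast, Units.val_pow_eq_pow_val, hu, hv]
    exact hj
  exact ⟨u, v, hu, hv, le_antisymm (key b a v u hv hu hba) (key a b u v hu hv hab)⟩

end PEquivalent

/-! ### The `2`-equivalence classes of odd prime powers. -/

section TwoAdic

/-- Squaring `1 + 2 ^ s + 2 ^ (s + 1) c` gives `1 + 2 ^ (s + 1)` modulo `2 ^ (s + 2)`, because `2 s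
≥ s + 2` once `s ≥ 2`. -/
theorem pow_two_pow_modEq {a : ℤ} {t : ℕ} (ht : 2 ≤ t) (ha : (2 : ℤ) ^ (t + 1) ∣ a - (1 + 2 ^ t))
    (i : ℕ) : (2 : ℤ) ^ (t + i + 1) ∣ a ^ 2 ^ i - (1 + 2 ^ (t + i)) := by
  induction i with
  | zero => simpa using ha
  | succ i ih =>
    obtain ⟨c, hc⟩ := ih
    obtain ⟨s, hs⟩ := Nat.exists_eq_add_of_le (show 2 ≤ t + i by omega)
    rw [hs] at hc
    have h1 : a ^ 2 ^ i = 1 + 2 ^ (2 + s) + 2 ^ (2 + s + 1) * c := by linarith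
    have h2 : t + (i + 1) = 2 + s + 1 := by omega
    rw [pow_succ 2 i, pow_mul, h1, h2]
    exact ⟨2 ^ s + c + 2 ^ (s + 2) * c + 2 ^ (s + 2) * c ^ 2, by ring⟩

/-- Two integers that are congruent to `1 + 2 ^ t` modulo `2 ^ (t + 1)` are `2`-adically
approximated by odd powers of each other. -/
theorem exists_odd_pow_sub_dvd {a b : ℤ} {t : ℕ} (ht : 2 ≤ t)
    (ha : (2 : ℤ) ^ (t + 1) ∣ a - (1 + 2 ^ t)) (hb : (2 : ℤ) ^ (t + 1) ∣ b - (1 + 2 ^ t)) (k : ℕ) :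
    ∃ j : ℕ, Odd j ∧ (2 : ℤ) ^ k ∣ b - a ^ j := by
  have key : ∀ i : ℕ, ∃ j : ℕ, Odd j ∧ (2 : ℤ) ^ (t + 1 + i) ∣ b - a ^ j := by
    intro i
    induction i with
    | zero => exact ⟨1, odd_one, by simpa using dvd_sub hb ha⟩
    | succ i ih =>
      obtain ⟨j, hj, c, hc⟩ := ih
      rcases Int.even_or_odd c with ⟨c', hc'⟩ | ⟨c', hc'⟩
      · exact ⟨j, hj, c', by rw [hc, hc']; ring⟩
      -- The factor `a ^ 2 ^ (i + 1)`, congruent to `1 + 2 ^ (t + i + 1)` modulo the next power of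
      -- `2`, corrects the one wrong binary digit; its exponent is even, so `j` stays odd.
      · refine ⟨j + 2 ^ (i + 1), ?_, ?_⟩
        · exact hj.add_even ((Nat.even_pow.2 ⟨even_two, by omega⟩))
        · obtain ⟨d, hd⟩ := pow_two_pow_modEq ht ha (i + 1)
          have hodd : Odd (a ^ j) := by
            have : Odd a := by
              obtain ⟨e, he⟩ := ha
              obtain ⟨s, rfl⟩ := Nat.exists_eq_add_of_le ht
              exact ⟨2 ^ (s + 1) + 2 ^ (2 + s) * e, by
                rw [show a = 1 + 2 ^ (2 + s) + 2 ^ (2 + s + 1) * e by linarith]; ring⟩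
            exact this.pow
          obtain ⟨f, hf⟩ := hodd
          have h1 : a ^ 2 ^ (i + 1) = 1 + 2 ^ (t + (i + 1)) + 2 ^ (t + (i + 1) + 1) * d := by
            linarith
          have h2 : b = a ^ j + 2 ^ (t + 1 + i) * (2 * c' + 1) := by rw [← hc']; linarith
          refine ⟨c' - f - d * a ^ j, ?_⟩
          rw [pow_add, h1, h2, hf]
          ring
  rcases le_total k (t + 1) with h | h
  · obtain ⟨j, hj, hd⟩ := key 0
    exact ⟨j, hj, (pow_dvd_pow 2 h).trans hd⟩
  · obtain ⟨i, rfl⟩ := Nat.exists_eq_add_of_le h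
    exact key i

/-- Odd exponents preserve the sign `s`, so the approximations of `a` and `b` by powers of each
other survive multiplication by `s`. -/
theorem pEquivalent_two_of_modEq {a b s : ℤ} (hs : s = 1 ∨ s = -1) {t : ℕ} (ht : 2 ≤ t)
    (ha : (2 : ℤ) ^ (t + 1) ∣ a - (1 + 2 ^ t)) (hb : (2 : ℤ) ^ (t + 1) ∣ b - (1 + 2 ^ t)) :
    PEquivalent 2 (s * a) (s * b) := by
  have hodd : ∀ a : ℤ, (2 : ℤ) ^ (t + 1) ∣ a - (1 + 2 ^ t) → ¬ ((2 : ℕ) : ℤ) ∣ s * a := by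
    intro a ha h
    have h1 : (2 : ℤ) ∣ a - (1 + 2 ^ t) := (dvd_pow_self 2 (by omega)).trans ha
    have h2 : (2 : ℤ) ∣ 2 ^ t := dvd_pow_self 2 (by omega)
    have h3 : (2 : ℤ) ∣ a := by
      rcases hs with rfl | rfl
      · simpa using h
      · simpa using h
    omega
  have key : ∀ a b : ℤ, (2 : ℤ) ^ (t + 1) ∣ a - (1 + 2 ^ t) → (2 : ℤ) ^ (t + 1) ∣ b - (1 + 2 ^ t) →
      ∀ k : ℕ, ∃ j : ℕ, ((2 : ℕ) : ℤ) ^ k ∣ s * b - (s * a) ^ j := by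
    intro a b ha hb k
    obtain ⟨j, hj, hd⟩ := exists_odd_pow_sub_dvd ht ha hb k
    refine ⟨j, ?_⟩
    have : s ^ j = s := by
      rcases hs with rfl | rfl
      · simp
      · exact hj.neg_one_pow
    rw [mul_pow, this, ← mul_sub]
    exact hd.mul_left s
  exact pEquivalent_of_forall_dvd (hodd a ha) (hodd b hb) (key a b ha hb) (key b a hb ha)

theorem three_pow_two_pow_modEq {e : ℕ} (he : 0 < e) :
    (2 : ℤ) ^ (e + 2 + 1) ∣ 3 ^ 2 ^ e - (1 + 2 ^ (e + 2)) := by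
  obtain ⟨i, rfl⟩ := Nat.exists_eq_add_of_le he
  have h := pow_two_pow_modEq (a := 9) (t := 3) (by norm_num) (by norm_num) i
  have h1 : (9 : ℤ) ^ 2 ^ i = 3 ^ 2 ^ (1 + i) := by
    rw [pow_add, pow_mul]
    norm_num
  rw [h1] at h
  convert h using 2
  · omega
  · congr 2
    omega

theorem exists_pEquivalent_three_pow {q : ℕ} (hq : Odd q) (h1 : q ≠ 1) :
    ∃ e : ℕ, PEquivalent 2 q (3 ^ 2 ^ e) ∨ PEquivalent 2 q (-3 ^ 2 ^ e) := by
  -- The class is determined by the sign `s` with `s q ≡ 1` modulo `4` and by `t = v₂(s q - 1) ≥ 2`.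
  -- The representative for `t = 2` is `-3 s`, which reverses the sign; for `t = e + 2 > 2` it is `s
  -- 3 ^ 2 ^ e`.
  obtain ⟨s, hs, hsq⟩ : ∃ s : ℤ, (s = 1 ∨ s = -1) ∧ 4 ∣ s * q - 1 := by
    obtain ⟨k, rfl⟩ := hq
    rcases Nat.even_or_odd' k with ⟨l, rfl | rfl⟩
    · exact ⟨1, Or.inl rfl, l, by push_cast; ring⟩
    · exact ⟨-1, Or.inr rfl, -l - 1, by push_cast; ring⟩
  have hne : s * q - 1 ≠ 0 := by
    rcases hs with rfl | rfl <;> omega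
  have hss : s * s = 1 := by rcases hs with rfl | rfl <;> rfl
  have hfin : FiniteMultiplicity (2 : ℤ) (s * q - 1) :=
    Int.finiteMultiplicity_iff.2 ⟨by decide, hne⟩
  obtain ⟨c, hc, hodd⟩ := hfin.exists_eq_pow_mul_and_not_dvd
  have ht : 2 ≤ multiplicity (2 : ℤ) (s * q - 1) := hfin.le_multiplicity_of_pow_dvd (by norm_num; exact hsq)
  set t := multiplicity (2 : ℤ) (s * q - 1)
  have ha : (2 : ℤ) ^ (t + 1) ∣ s * q - (1 + 2 ^ t) := by
    obtain ⟨d, rfl⟩ : Odd c := by rwa [← Int.not_even_iff_odd, even_iff_two_dvd]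
    exact ⟨d, by rw [pow_succ]; linarith⟩
  have hq : (q : ℤ) = s * (s * q) := by rw [← mul_assoc, hss, one_mul]
  obtain ⟨e, he⟩ := Nat.exists_eq_add_of_le ht
  rcases Nat.eq_zero_or_pos e with rfl | hpos
  · have hb : (2 : ℤ) ^ (t + 1) ∣ -3 - (1 + 2 ^ t) := by rw [he]; norm_num
    have h := pEquivalent_two_of_modEq hs ht ha hb
    rw [← hq] at h
    refine ⟨0, ?_⟩
    rcases hs with rfl | rfl
    · exact Or.inr (by simpa using h)
    · exact Or.inl (by simpa using h)
  · have hb : (2 : ℤ) ^ (t + 1) ∣ 3 ^ 2 ^ e - (1 + 2 ^ t) := by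
      rw [he, add_comm 2 e]; exact three_pow_two_pow_modEq hpos
    have h := pEquivalent_two_of_modEq hs ht ha hb
    rw [← hq] at h
    refine ⟨e, ?_⟩
    rcases hs with rfl | rfl
    · exact Or.inl (by simpa using h)
    · exact Or.inr (by simpa using h)

theorem exists_isPrimePow_pEquivalent_three_pow (e : ℕ) :
    ∃ q : ℕ, IsPrimePow q ∧ PEquivalent 2 q (3 ^ 2 ^ e) := by
  refine ⟨3 ^ 2 ^ e, Nat.prime_three.isPrimePow.pow (by positivity), ?_⟩
  push_cast
  refine PEquivalent.refl fun h => ?_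
  have h2 := Int.prime_two.dvd_of_dvd_pow h
  omega

theorem exists_isPrimePow_pEquivalent_neg_three_pow (e : ℕ) :
    ∃ q : ℕ, IsPrimePow q ∧ PEquivalent 2 q (-3 ^ 2 ^ e) := by
  rcases Nat.eq_zero_or_pos e with rfl | he
  · refine ⟨5, Nat.prime_five.isPrimePow, ?_⟩
    have := pEquivalent_two_of_modEq (a := 5) (b := -3) (s := 1) (t := 2) (Or.inl rfl) le_rfl
      (by norm_num) (by norm_num)
    simpa using this
  · have hcop : IsCoprime (-3 ^ 2 ^ e : ℤ) ((2 ^ (e + 2 + 1) : ℕ) : ℤ) := by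
      push_cast
      exact (IsCoprime.pow (by norm_num)).neg_left
    -- Dirichlet's theorem: a prime congruent to `-3 ^ 2 ^ e` modulo `2 ^ (e + 3)` lies in the
    -- required class.
    obtain ⟨q, -, hq, hmod⟩ := Nat.forall_exists_prime_gt_and_zmodEq 0
      (q := 2 ^ (e + 2 + 1)) (by positivity) hcop
    refine ⟨q, hq.isPrimePow, ?_⟩
    have h3 := three_pow_two_pow_modEq he
    have h4 : (2 : ℤ) ^ (e + 2 + 1) ∣ -q - (1 + 2 ^ (e + 2)) := by
      obtain ⟨x, hx⟩ := hmod.dvd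
      obtain ⟨y, hy⟩ := h3
      push_cast at hx
      exact ⟨x + y, by linear_combination hx + hy⟩
    have := pEquivalent_two_of_modEq (s := -1) (Or.inr rfl) (by omega) h4 h3
    simpa using this

end TwoAdic

/-! ### The `2`-adic valuations of `a ^ n - 1`. -/

section Valuations

theorem padicValInt_two_pow_sub_one {a : ℤ} (ha : 4 ∣ a - 1) (h1 : a ≠ 1) (h2 : a ≠ -1) {n : ℕ}
    (hn : n ≠ 0) : padicValInt 2 (a ^ n - 1) = padicValInt 2 (a - 1) + padicValNat 2 n := by
  have hne : a ^ n - 1 ≠ 0 := by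
    intro h
    rcases Int.isUnit_iff.1 (IsUnit.of_pow_eq_one (sub_eq_zero.1 h) hn) with h | h
    · exact h1 h
    · exact h2 h
  have hval : ∀ x : ℤ, x ≠ 0 → ((padicValInt 2 x : ℕ) : ℕ∞) = emultiplicity 2 x := by
    intro x hx
    rw [padicValInt, padicValNat_eq_emultiplicity (Int.natAbs_ne_zero.2 hx),
      emultiplicity_eq_emultiplicity_iff]
    intro k
    rw [← Int.natCast_dvd]
    push_cast
    rfl
  have h := Int.two_pow_sub_pow' (x := a) (y := 1) n ha (by omega)
  rw [one_pow, ← hval _ hne, ← hval _ (sub_ne_zero.2 h1), ← hval _ (by exact_mod_cast hn)] at h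
  rw [padicValInt.of_nat] at h
  exact_mod_cast h

theorem padicValInt_neg_three_pow_sub_one {n : ℕ} (hn : n ≠ 0) :
    padicValInt 2 ((-3) ^ n - 1) = 2 + padicValNat 2 n := by
  rw [padicValInt_two_pow_sub_one (by norm_num) (by norm_num) (by norm_num) hn]
  congr 1
  rw [show (-3 - 1 : ℤ) = -(2 ^ 2 : ℕ) by norm_num, padicValInt, Int.natAbs_neg, Int.natAbs_natCast,
    padicValNat.prime_pow]

theorem padicValInt_nine_pow_sub_one {n : ℕ} (hn : n ≠ 0) :
    padicValInt 2 (9 ^ n - 1) = 3 + padicValNat 2 n := by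
  rw [padicValInt_two_pow_sub_one (by norm_num) (by norm_num) (by norm_num) hn]
  congr 1
  rw [show (9 - 1 : ℤ) = (2 ^ 3 : ℕ) by norm_num, padicValInt, Int.natAbs_natCast,
    padicValNat.prime_pow]

theorem padicValInt_three_pow_sub_one {e n : ℕ} (he : 0 < e) (hn : n ≠ 0) :
    padicValInt 2 ((3 ^ 2 ^ e) ^ n - 1) = e + (2 + padicValNat 2 n) := by
  obtain ⟨i, rfl⟩ := Nat.exists_eq_add_of_le he
  rw [pow_add, pow_one, pow_mul, ← pow_mul, show (3 ^ 2 : ℤ) = 9 by norm_num,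
    padicValInt_nine_pow_sub_one (by positivity), padicValNat.mul (by positivity) hn,
    padicValNat.prime_pow]
  omega

theorem padicValInt_two_eq_one {x : ℤ} (h : x % 4 = 2) : padicValInt 2 x = 1 := by
  apply le_antisymm
  · by_contra! hc
    have : ((2 : ℕ) : ℤ) ^ 2 ∣ x := (padicValInt_dvd_iff _ _).2 (Or.inr hc)
    norm_num at this
    omega
  · have : ((2 : ℕ) : ℤ) ^ 1 ∣ x := by norm_num; omega
    exact ((padicValInt_dvd_iff _ _).1 this).resolve_left (by omega)

theorem padicValInt_odd_pow_sub_one {a : ℤ} (ha : a % 4 = 3) {n : ℕ} (hn : Odd n) :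
    padicValInt 2 (a ^ n - 1) = 1 := by
  apply padicValInt_two_eq_one
  have h : a ^ n ≡ -1 [ZMOD 4] := by
    have h1 : a ≡ -1 [ZMOD 4] := by rw [Int.ModEq, ha]; rfl
    simpa [hn.neg_one_pow] using h1.pow n
  have h2 : a ^ n - 1 ≡ 2 [ZMOD 4] := by
    have := h.sub_right 1
    exact this.trans (by decide)
  exact h2

/-- Passing to `a ^ 2` removes the sign and leaves a power of `9`. The sum is grouped to display the
valuation `2 + v₂(m)` belonging to `-3` at `m`. -/
theorem padicValInt_even_pow_sub_one {a : ℤ} {e : ℕ} (ha : a ^ 2 = 9 ^ 2 ^ e) {m : ℕ} (hm : m ≠ 0) :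
    padicValInt 2 (a ^ (2 * m) - 1) = 1 + e + (2 + padicValNat 2 m) := by
  rw [pow_mul, ha, ← pow_mul, padicValInt_nine_pow_sub_one (by positivity),
    padicValNat.mul (by positivity) hm, padicValNat.prime_pow]
  omega

end Valuations

/-! ### Rational powers and square roots of series. -/

section SeriesIdentities

open PowerSeries

/-- `F ^ c` is the square of `F ^ (c / 2)`. Nonnegativity excludes the constant term `-1` when
square roots are compared. -/
theorem constantCoeff_seriesPow_nonneg {F : ℚ⟦X⟧} (hF : constantCoeff F = 1) (c : ℚ) :
    0 ≤ constantCoeff (seriesPow F c) := by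
  have h := seriesPow_add hF (c / 2) (c / 2)
  rw [add_halves] at h
  rw [h, map_mul]
  exact mul_self_nonneg _

/-- Squaring doubles the exponent `2 ^ (r - 2)` to the natural number `2 ^ (r - 1)`, including the
case `r = 1` of a square root. -/
theorem seriesPow_two_zpow_sq {F : ℚ⟦X⟧} (hF : constantCoeff F = 1) {r : ℕ} (hr : 1 ≤ r) :
    seriesPow F (2 ^ ((r : ℤ) - 2)) ^ 2 = F ^ 2 ^ (r - 1) := by
  have h : (2 : ℚ) ^ ((r : ℤ) - 2) + 2 ^ ((r : ℤ) - 2) = ((2 ^ (r - 1) : ℕ) : ℚ) := by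
    obtain ⟨s, rfl⟩ := Nat.exists_eq_add_of_le hr
    rw [← two_mul, ← zpow_one_add₀ two_ne_zero]
    push_cast
    rw [← zpow_natCast]
    congr 1
    push_cast [Nat.add_sub_cancel_left]
    ring
  rw [sq, ← seriesPow_add hF, h, seriesPow_natCast hF]

theorem constantCoeff_seriesPow {F : ℚ⟦X⟧} (hF : constantCoeff F = 1) {r : ℕ} (hr : 1 ≤ r) :
    constantCoeff (seriesPow F (2 ^ ((r : ℤ) - 2))) = 1 := by
  have h := congrArg constantCoeff (seriesPow_two_zpow_sq hF hr)
  rw [map_pow, map_pow, hF, one_pow] at h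
  exact (pow_eq_one_iff_of_nonneg (constantCoeff_seriesPow_nonneg hF _) two_ne_zero).1 h

theorem eq_of_sq_eq_of_constantCoeff_eq_one {F G : ℚ⟦X⟧} (h : F ^ 2 = G ^ 2)
    (hF : constantCoeff F = 1) (hG : constantCoeff G = 1) : F = G := by
  rcases sq_eq_sq_iff_eq_or_eq_neg.1 h with h | h
  · exact h
  · have := congrArg constantCoeff h
    rw [map_neg, hF, hG] at this
    norm_num at this

theorem HasLogDeriv.of_mul_right {F G C D : ℚ⟦X⟧} (hFG : HasLogDeriv (F * G) C)
    (hG : HasLogDeriv G D) (h0 : G ≠ 0) : HasLogDeriv F (C - D) := by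
  unfold HasLogDeriv at *
  rw [Derivation.leibniz, smul_eq_mul, smul_eq_mul] at hFG
  refine mul_right_cancel₀ h0 ?_
  linear_combination hFG - F * hG

theorem hasLogDeriv_one_sub_X :
    HasLogDeriv (1 - X) (-mk fun n => if n = 0 then 0 else (1 : ℚ)) := by
  have := hasLogDeriv_one_sub_X_pow one_ne_zero
  simpa using this

theorem hasLogDeriv_one_add_X : HasLogDeriv (1 + X)
    ((-mk fun n => if n = 0 then 0 else if 2 ∣ n then (2 : ℚ) else 0) -
      (-mk fun n => if n = 0 then 0 else (1 : ℚ))) := by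
  refine HasLogDeriv.of_mul_right (G := 1 - X) ?_ hasLogDeriv_one_sub_X ?_
  · have := hasLogDeriv_one_sub_X_pow two_ne_zero
    rw [show (1 + X) * (1 - X) = (1 - X ^ 2 : ℚ⟦X⟧) by ring]
    exact_mod_cast this
  · intro h
    have := congrArg constantCoeff h
    simp at this

theorem constantCoeff_primaryGenFun (p : ℕ) [Fact p.Prime] (r : ℕ) (K : Type*) [Field K] :
    constantCoeff (primaryGenFun p r K) = 1 := by
  rw [← coeff_zero_eq_constantCoeff_apply, primaryGenFun, coeff_mk, if_pos rfl]

theorem constantCoeff_mk_pPartCoeff (p r q : ℕ) :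
    constantCoeff (mk (pPartCoeff p r q)) = 0 := by
  rw [← coeff_zero_eq_constantCoeff_apply, coeff_mk, pPartCoeff, if_pos rfl]

end SeriesIdentities

/-! ### The identities between generating functions. -/

section Main

open PowerSeries

theorem padicValNat_eq_of_pEquivalent {q : ℕ} (hq : 0 < q) {a : ℤ} (h : PEquivalent 2 q a) (n : ℕ) :
    padicValNat 2 (q ^ n - 1) = padicValInt 2 (a ^ n - 1) := by
  rw [← h.padicValInt_pow_sub_one, ← padicValInt.of_nat, Nat.cast_sub (Nat.one_le_pow _ _ hq)]
  push_cast
  rfl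

theorem two_ne_zero_of_pEquivalent {K : Type*} [Field K] [Finite K] {a : ℤ}
    (h : PEquivalent 2 (Nat.card K) a) : ((2 : ℕ) : K) ≠ 0 := by
  intro h2
  have h3 : addOrderOf (1 : K) = 2 :=
    addOrderOf_eq_prime (by rw [nsmul_eq_mul, h2, zero_mul]) one_ne_zero
  have h4 : 2 ∣ Nat.card K := h3 ▸ addOrderOf_dvd_natCard (1 : K)
  exact h.not_dvd (by exact_mod_cast h4)

variable {K : Type*} [Field K] [Finite K] {L : Type*} [Field L] [Finite L] {r : ℕ}

theorem primaryGenFun_eq_of_pEquivalent (h : PEquivalent 2 (Nat.card K) (Nat.card L)) :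
    primaryGenFun 2 r K = primaryGenFun 2 r L := by
  refine (hasLogDeriv_primaryGenFun 2 K (two_ne_zero_of_pEquivalent h) r).eq (C := _) ?_
    ((map_neg constantCoeff _).trans (by rw [constantCoeff_mk_pPartCoeff, neg_zero]))
    ((constantCoeff_primaryGenFun 2 r K).trans (constantCoeff_primaryGenFun 2 r L).symm)
  have hc : pPartCoeff 2 r (Nat.card K) = pPartCoeff 2 r (Nat.card L) := by
    funext n
    unfold pPartCoeff
    have hn := padicValNat_eq_of_pEquivalent Nat.card_pos h n
    have hn' := padicValNat_eq_of_pEquivalent Nat.card_pos h.symm n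
    rw [← h.padicValInt_pow_sub_one] at hn
    rw [hn, ← hn']
  rw [hc]
  exact hasLogDeriv_primaryGenFun 2 L (two_ne_zero_of_pEquivalent h.symm) r

theorem pPartCoeff_neg_three (h : PEquivalent 2 (Nat.card K) (-3)) {n : ℕ} (hn : n ≠ 0) :
    pPartCoeff 2 r (Nat.card K) n = (2 ^ (2 + padicValNat 2 n)) ^ (r - 1) := by
  rw [pPartCoeff, if_neg hn, padicValNat_eq_of_pEquivalent Nat.card_pos h,
    padicValInt_neg_three_pow_sub_one hn]
  push_cast
  rfl

theorem primaryGenFun_three_pow (hK : PEquivalent 2 (Nat.card K) (-3)) {e : ℕ} (he : 0 < e)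
    (hL : PEquivalent 2 (Nat.card L) (3 ^ 2 ^ e)) :
    primaryGenFun 2 r L = primaryGenFun 2 r K ^ 2 ^ (e * (r - 1)) := by
  have h1 := hasLogDeriv_primaryGenFun 2 L (two_ne_zero_of_pEquivalent hL) r
  have h2 := (hasLogDeriv_primaryGenFun 2 K (two_ne_zero_of_pEquivalent hK) r).pow
    (2 ^ (e * (r - 1)))
  refine h1.eq (C := _) ?_
    ((map_neg constantCoeff _).trans (by rw [constantCoeff_mk_pPartCoeff, neg_zero])) ?_
  · convert h2 using 1
    ext n
    rw [← map_natCast (C (R := ℚ)), coeff_C_mul]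
    simp only [map_neg, coeff_mk]
    rcases eq_or_ne n 0 with rfl | hn
    · simp [pPartCoeff]
    · rw [pPartCoeff_neg_three hK hn, pPartCoeff, if_neg hn,
        padicValNat_eq_of_pEquivalent Nat.card_pos hL, padicValInt_three_pow_sub_one he hn]
      push_cast
      rw [pow_add 2 e, mul_pow, ← pow_mul 2 e]
      ring
  · rw [map_pow, constantCoeff_primaryGenFun, constantCoeff_primaryGenFun, one_pow]

/-- One statement for `a = 3` (with `e = 0`) and `a = -3 ^ 2 ^ e`, since only `a` modulo `4` and `a
^ 2` enter. After squaring, both sides have constant term `1`, and it remains to compare logarithmic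
derivatives. -/
theorem primaryGenFun_neg_three_pow (hr : 1 ≤ r) (hK : PEquivalent 2 (Nat.card K) (-3)) {e : ℕ}
    {a : ℤ} (ha : a % 4 = 3) (ha2 : a ^ 2 = 9 ^ 2 ^ e) (hL : PEquivalent 2 (Nat.card L) a) :
    seriesPow (1 + X) (2 ^ ((r : ℤ) - 2)) * primaryGenFun 2 r L =
      seriesPow ((1 - X) * expand 2 two_ne_zero (primaryGenFun 2 r K) ^ 2 ^ (e * (r - 1)))
        (2 ^ ((r : ℤ) - 2)) := by
  have hA : constantCoeff (1 + X : ℚ⟦X⟧) = 1 := by simp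
  have hB : constantCoeff ((1 - X) *
      expand 2 two_ne_zero (primaryGenFun 2 r K) ^ 2 ^ (e * (r - 1))) = 1 := by
    rw [map_mul, map_pow, constantCoeff_expand, constantCoeff_primaryGenFun]
    simp
  refine eq_of_sq_eq_of_constantCoeff_eq_one ?_ ?_ (constantCoeff_seriesPow hB hr)
  · rw [mul_pow, seriesPow_two_zpow_sq hA hr, seriesPow_two_zpow_sq hB hr]
    have h1 := (hasLogDeriv_one_add_X.pow (2 ^ (r - 1))).mul
      ((hasLogDeriv_primaryGenFun 2 L (two_ne_zero_of_pEquivalent hL) r).pow 2)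
    have h2 := (hasLogDeriv_one_sub_X.mul ((hasLogDeriv_primaryGenFun 2 K
      (two_ne_zero_of_pEquivalent hK) r).expand_two.pow (2 ^ (e * (r - 1))))).pow (2 ^ (r - 1))
    have hC : ((2 ^ (r - 1) : ℕ) : ℚ⟦X⟧) *
        ((-mk fun n => if n = 0 then 0 else if 2 ∣ n then (2 : ℚ) else 0) -
          (-mk fun n => if n = 0 then 0 else (1 : ℚ))) +
        ((2 : ℕ) : ℚ⟦X⟧) * -mk (pPartCoeff 2 r (Nat.card L)) =
        ((2 ^ (r - 1) : ℕ) : ℚ⟦X⟧) * ((-mk fun n => if n = 0 then 0 else (1 : ℚ)) +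
          ((2 ^ (e * (r - 1)) : ℕ) : ℚ⟦X⟧) *
            (2 * expand 2 two_ne_zero (-mk (pPartCoeff 2 r (Nat.card K))))) := by
      ext n
      have htwo : (2 : ℚ⟦X⟧) = C (2 : ℚ) := by rw [map_ofNat]
      rw [map_add, ← map_natCast (C (R := ℚ)), ← map_natCast (C (R := ℚ)),
        ← map_natCast (C (R := ℚ)), htwo]
      simp only [coeff_C_mul, map_add, map_sub, map_neg, coeff_mk, coeff_expand]
      rcases eq_or_ne n 0 with rfl | hn
      · simp [pPartCoeff]
      · rw [if_neg hn, if_neg hn, pPartCoeff, if_neg hn,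
          padicValNat_eq_of_pEquivalent Nat.card_pos hL]
        -- With `M = 2 ^ (r - 1)`, both coefficients at odd `n` are `M - 2 M = -M`. At `n = 2m` both
        -- are `-M - 2 M ^ (1 + e) cₘ`, where `-cₘ` is the coefficient for `-3` at `m`.
        rcases Nat.even_or_odd n with h | h
        · obtain ⟨m, rfl⟩ := even_iff_two_dvd.1 h
          have hm : m ≠ 0 := by omega
          rw [if_pos (dvd_mul_right _ _), if_pos (dvd_mul_right _ _),
            Nat.mul_div_cancel_left _ two_pos, pPartCoeff_neg_three hK hm,
            padicValInt_even_pow_sub_one ha2 hm]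
          push_cast
          rw [pow_add 2 (1 + e), mul_pow, ← pow_mul 2 (1 + e), add_mul, pow_add 2 (1 * (r - 1)),
            one_mul]
          ring
        · have hnd : ¬ 2 ∣ n := by rw [← even_iff_two_dvd]; exact Nat.not_even_iff_odd.2 h
          rw [if_neg hnd, if_neg hnd, padicValInt_odd_pow_sub_one ha h]
          push_cast
          ring
    rw [← hC] at h2
    refine h1.eq h2 ?_ ?_
    · simp only [← coeff_zero_eq_constantCoeff_apply]
      rw [map_add, ← map_natCast (C (R := ℚ)), ← map_natCast (C (R := ℚ))]
      simp only [coeff_C_mul, map_sub, map_neg, coeff_mk]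
      simp [pPartCoeff]
    · rw [map_pow, hB, map_mul, map_pow, map_pow, hA, constantCoeff_primaryGenFun]
      simp
  · rw [map_mul, constantCoeff_seriesPow hA hr, constantCoeff_primaryGenFun, one_mul]

end Main
theorem mainTheorem10 :
    (∀ q : ℕ, IsPrimePow q → Odd q →
      ∃ e : ℕ, PEquivalent 2 q (3 ^ 2 ^ e) ∨ PEquivalent 2 q (-3 ^ 2 ^ e)) ∧
    (∀ e : ℕ, (∃ q : ℕ, IsPrimePow q ∧ PEquivalent 2 q (3 ^ 2 ^ e)) ∧
      ∃ q : ℕ, IsPrimePow q ∧ PEquivalent 2 q (-3 ^ 2 ^ e)) ∧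
    ∀ r : ℕ, 1 ≤ r →
      (∀ (K : Type u) [Field K] [Finite K] (L : Type v) [Field L] [Finite L],
        PEquivalent 2 (Nat.card K) (Nat.card L) → primaryGenFun 2 r K = primaryGenFun 2 r L) ∧
      ∀ (K : Type u) [Field K] [Finite K], PEquivalent 2 (Nat.card K) (-3) →
        (∀ (L : Type v) [Field L] [Finite L], PEquivalent 2 (Nat.card L) 3 →
          seriesPow (1 + PowerSeries.X) (2 ^ ((r : ℤ) - 2)) * primaryGenFun 2 r L =
            seriesPow ((1 - PowerSeries.X) *
              PowerSeries.expand 2 two_ne_zero (primaryGenFun 2 r K)) (2 ^ ((r : ℤ) - 2))) ∧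
        (∀ e : ℕ, 0 < e → ∀ (L : Type v) [Field L] [Finite L],
          PEquivalent 2 (Nat.card L) (3 ^ 2 ^ e) →
          primaryGenFun 2 r L = primaryGenFun 2 r K ^ 2 ^ (e * (r - 1))) ∧
        (∀ e : ℕ, 0 < e → ∀ (L : Type v) [Field L] [Finite L],
          PEquivalent 2 (Nat.card L) (-3 ^ 2 ^ e) →
          seriesPow (1 + PowerSeries.X) (2 ^ ((r : ℤ) - 2)) * primaryGenFun 2 r L =
            seriesPow ((1 - PowerSeries.X) *
              PowerSeries.expand 2 two_ne_zero (primaryGenFun 2 r K) ^ 2 ^ (e * (r - 1)))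
              (2 ^ ((r : ℤ) - 2))) := by
  refine ⟨fun q hq hodd => exists_pEquivalent_three_pow hodd hq.one_lt.ne', fun e =>
    ⟨exists_isPrimePow_pEquivalent_three_pow e, exists_isPrimePow_pEquivalent_neg_three_pow e⟩,
    fun r hr => ⟨fun K _ _ L _ _ h => primaryGenFun_eq_of_pEquivalent h, fun K _ _ hK =>
      ⟨fun L _ _ hL => ?_, fun e he L _ _ hL => primaryGenFun_three_pow hK he hL,
        fun e he L _ _ hL => ?_⟩⟩⟩
  · have h := primaryGenFun_neg_three_pow hr hK (e := 0) (a := 3) (by norm_num) (by norm_num) hL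
    simpa using h
  · refine primaryGenFun_neg_three_pow hr hK ?_ ?_ hL
    · obtain ⟨c, hc⟩ := three_pow_two_pow_modEq he
      -- Only the residue modulo `4` is wanted: `3 ^ 2 ^ e ≡ 1`, so its negative is `3`.
      have h4 : (3 : ℤ) ^ 2 ^ e = 1 + 4 * (2 ^ e + 2 * 2 ^ e * c) := by linear_combination hc
      generalize (2 : ℤ) ^ e + 2 * 2 ^ e * c = x at h4
      omega
    · rw [neg_sq, ← pow_mul, mul_comm, pow_mul]
      norm_num
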